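/- Let $k\ge 2$ be an integer and let $\omega>1$, $\lambda>0$ and $\epsilon>0$ be fixed real numbers. Write $\pi(u)$ for the number of primes up to $u$ and $\psi(u)=\sum_{n\le u}\Lambda(n)$, where $\Lambda$ is the von Mangoldt function. For integers $\ell\ge1$ let $$\mathcal{R}_{\ell,\omega}(\lambda)=\frac{\mathcal{P}_\ell(\omega\lambda)}{(\omega-1)\lambda},\qquad \mathcal{P}_\ell(y)=\sum_{r=1}^{\ell} S(\ell,r)\,2^r\,r!\,y^r,$$ where $S(\ell,r)$ is the Stirling number of the second kind, i.e. the number of partitions of an $\ell$-element set into $r$ non-empty subsets. Then there is $X_0=X_0(k,\omega,\lambda,\epsilon)$ such that for all real $X\ge X_0$ $$\sum_{p\le X}\bigl(\psi(p+\lambda\log X)-\psi(p)\bigr)^k\le\bigl(\mathcal{R}_{k+1,\omega}(\lambda)+\epsilon\bigr)\,X\log^{k-1}X$$ and $$\sum_{p\le X}\bigl(\pi(p+\lambda\log X)-\pi(p)\bigr)^k\le\bigl(\mathcal{R}_{k+1,\omega}(\lambda)+\epsilon\bigr)\,\frac{X}{\log X},$$ where the sums run over primes $p\le X$. -/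

import Mathlib

namespace PrimeMoments

/-- The polynomial `P_k(y) = ∑_{r=1}^k S(k, r) 2^r r! y^r`, where `S(k, r)` is the Stirling number
of the second kind: the number of partitions of a `k`-element set into `r` non-empty subsets. -/
noncomputable def P (k : ℕ) (y : ℝ) : ℝ :=
  ∑ r ∈ Finset.Icc 1 k, (Nat.stirlingSecond k r : ℝ) * 2 ^ r * (r.factorial : ℝ) * y ^ r

/-- `R_{k,ω}(lam) = P_k(ω lam) / ((ω - 1) lam)`, used for `ω > 1` and `lam > 0`. -/
noncomputable def R (k : ℕ) (ω lam : ℝ) : ℝ :=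
  P k (ω * lam) / ((ω - 1) * lam)

/-- The number of primes up to the real number `u`, as a real number. -/
noncomputable def primePi (u : ℝ) : ℝ := (Nat.primeCounting ⌊u⌋₊ : ℝ)

end PrimeMoments

/-!
# Moments of primes in short intervals starting at primes

Write `L = log X`. If `p` is a prime in `(n, n + (ω - 1)λL]`, then the interval `(p, p + λL]` is
contained in `(n, n + ωλL]`, which also contains `p`. So the sum of `(π(p + λL) - π(p)) ^ k` over
the primes `p` of `(n, n + (ω - 1)λL]` is at most `(π(n + ωλL) - π(n)) ^ (k + 1)`. Summing over
`n ≤ X` counts every prime about `(ω - 1)λL` times, and reduces the bound for `π` to an upper bound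
`(P (k + 1) (ωλ) + o(1)) X` for a `(k + 1)`-st moment over all integers
(`PrimeMoments.mul_sum_primeWindow_pow_le`). The bound for `ψ` follows, because prime powers are
negligible and `Λ(q) ≤ log (2X)` at the primes `q` involved.

A power is a combination of falling factorials with Stirling numbers as coefficients, and the
falling factorial of the number of primes in `(n, n + H]` counts the injective tuples
`h ∈ {1, …, H}^r` for which all `n + hᵢ` are prime. It therefore suffices to bound the number of such
`n ≤ X` on average over `h` by `2 ^ r r! X / L ^ r`
(`PrimeMoments.eventually_sum_descFactorial_le`).

Fix a large `w`, put `W = ∏_{p ≤ w} p`, and treat each residue class of `n` modulo `W` separately.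
At most the classes `b` for which every `b + hᵢ` is coprime to `W` contribute. In such a class apply
the Selberg sieve (`BoundingSieve.siftedSum_le_selberg`) of level about `√X`, using only the primes
`p > w` that divide no difference `hᵢ - hⱼ`. At these primes exactly `r` classes are removed. The
Selberg sum is compared prime by prime with `∑_{n ≤ R} τ_r(n) / n ≥ (log R) ^ r / r!`; every prime
that is not used costs a factor `(1 - 1/p)^{-r}` (`PrimeMoments.log_pow_le_primeSetSum`).

The factors at `p ≤ w` are compensated by the number of admissible classes `b`, on average over the
tuples (`PrimeMoments.sum_card_goodClasses_le`). The factors at the primes `p > w` dividing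
differences are, on average, `1 + O(1/w)` (`PrimeMoments.sum_diffFactor_sub_one_le`), and this error
beats the density `∏_{p ≤ w} (1 - 1/p)^r` by Chebyshev's bound
(`PrimeMoments.exists_mertensProd_pow_mul_le`). No singular series has to be averaged.
-/

/-! ### The Selberg sieve with optimal weights -/

namespace BoundingSieve

open Finset Nat ArithmeticFunction
open scoped ArithmeticFunction.Moebius

variable (s : BoundingSieve)

/-- The Selberg sum `∑_{l ∣ P, l ≤ R} g(l)`, whose reciprocal is the optimal sieving density
with weights supported on divisors up to `R`. -/
noncomputable def selbergSum (R : ℕ) : ℝ :=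
  ∑ l ∈ s.prodPrimes.divisors with l ≤ R, s.selbergTerms l

/-- The Selberg weights `λ_d = μ(d) ν(d)⁻¹ G⁻¹ ∑_{d ∣ l, l ≤ R} g(l)`, the minimiser of the main
term of the `Λ²` sieve under `λ_1 = 1`, where `G` is `BoundingSieve.selbergSum`. -/
noncomputable def selbergWeight (R d : ℕ) : ℝ :=
  (s.nu d)⁻¹ * (μ d : ℝ) * (s.selbergSum R)⁻¹ *
    ∑ l ∈ s.prodPrimes.divisors with l ≤ R ∧ d ∣ l, s.selbergTerms l

variable {s}

theorem selbergSum_pos {R : ℕ} (hR : 1 ≤ R) : 0 < s.selbergSum R := by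
  refine sum_pos (fun l hl => selbergTerms_pos (Nat.dvd_of_mem_divisors (mem_filter.1 hl).1))
    ⟨1, ?_⟩
  simp [prodPrimes_ne_zero, hR]

theorem selbergWeight_one {R : ℕ} (hR : 1 ≤ R) : s.selbergWeight R 1 = 1 := by
  have h := (selbergSum_pos (s := s) hR).ne'
  simp only [selbergWeight, s.nu_mult.map_one, one_dvd, and_true, moebius_apply_one]
  rw [← selbergSum]
  field_simp
  simp

theorem selbergWeight_eq_zero {R d : ℕ} (hd : R < d) : s.selbergWeight R d = 0 := by
  rw [selbergWeight, Finset.sum_eq_zero, mul_zero]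
  intro l hl
  simp only [mem_filter, Nat.mem_divisors] at hl
  have : 0 < l := Nat.pos_of_ne_zero (ne_zero_of_dvd_ne_zero prodPrimes_ne_zero hl.1.1)
  have := Nat.le_of_dvd this hl.2.2
  omega

/-- For squarefree `m`, the sum of `μ(d)` over `l ∣ d ∣ m` is `μ(l)` or `0` according to whether
`l = m` or not. -/
theorem sum_moebius_between {l m : ℕ} (hm : Squarefree m) (hl : l ∣ m) :
    ∑ d ∈ m.divisors with l ∣ d, (μ d : ℝ) = if l = m then (μ l : ℝ) else 0 := by
  obtain ⟨k, rfl⟩ := hl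
  have hl0 : l ≠ 0 := by rintro rfl; simp at hm
  have hk0 : k ≠ 0 := by rintro rfl; simp at hm
  have key : ∑ d ∈ (l * k).divisors with l ∣ d, (μ d : ℝ) =
      ∑ e ∈ k.divisors, (μ l : ℝ) * (μ e : ℝ) := by
    symm
    refine Finset.sum_bij (fun e _ => l * e) ?_ ?_ ?_ ?_
    · intro e he
      simp only [Nat.mem_divisors, mem_filter] at he ⊢
      exact ⟨⟨Nat.mul_dvd_mul_left l he.1, mul_ne_zero hl0 hk0⟩, Dvd.intro _ rfl⟩
    · intro a _ b _ hab
      exact Nat.eq_of_mul_eq_mul_left (Nat.pos_of_ne_zero hl0) hab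
    · intro d hd
      simp only [Nat.mem_divisors, mem_filter] at hd
      obtain ⟨e, rfl⟩ := hd.2
      refine ⟨e, ?_, rfl⟩
      simp only [Nat.mem_divisors]
      exact ⟨Nat.dvd_of_mul_dvd_mul_left (Nat.pos_of_ne_zero hl0) hd.1.1, hk0⟩
    · intro e he
      have hc : l.Coprime e := ((Nat.squarefree_mul_iff.1 hm).1).coprime_dvd_right
        (Nat.dvd_of_mem_divisors he)
      rw [isMultiplicative_moebius.map_mul_of_coprime hc]
      push_cast
      ring
  rw [key, ← Finset.mul_sum]
  have h1 : (∑ e ∈ k.divisors, (μ e : ℝ)) = if k = 1 then 1 else 0 := by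
    have := congrArg (fun f : ArithmeticFunction ℤ => f k) moebius_mul_coe_zeta
    simp only [coe_mul_zeta_apply, ArithmeticFunction.one_apply] at this
    exact_mod_cast this
  rw [h1]
  by_cases hk : k = 1
  · simp [hk]
  · have : ¬ l = l * k := fun h => hk (by
      have : l * 1 = l * k := by simpa using h
      exact (Nat.eq_of_mul_eq_mul_left (Nat.pos_of_ne_zero hl0) this).symm)
    simp [hk, this]

/-- The weights diagonalise the quadratic form: the new variables are `μ(l) g(l) / G`. -/
theorem sum_nu_mul_selbergWeight {R l : ℕ} (hl : l ∣ s.prodPrimes) :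
    (∑ d ∈ s.prodPrimes.divisors, if l ∣ d then s.nu d * s.selbergWeight R d else 0) =
      if l ≤ R then (s.selbergSum R)⁻¹ * (μ l : ℝ) * s.selbergTerms l else 0 := by
  have h1 : ∀ d ∈ s.prodPrimes.divisors,
      (if l ∣ d then s.nu d * s.selbergWeight R d else 0) =
      ∑ m ∈ s.prodPrimes.divisors with m ≤ R,
        (s.selbergSum R)⁻¹ * s.selbergTerms m * if d ∣ m ∧ l ∣ d then (μ d : ℝ) else 0 := by
    intro d hd
    have hnu := nu_ne_zero (Nat.dvd_of_mem_divisors hd)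
    split_ifs with h
    · rw [selbergWeight, ← filter_filter, sum_filter (p := fun l => d ∣ l), Finset.mul_sum,
        Finset.mul_sum]
      refine Finset.sum_congr rfl fun m _ => ?_
      by_cases hdm : d ∣ m
      · simp only [hdm, h, and_self, if_true]
        field_simp
      · simp [hdm]
    · simp [h]
  rw [Finset.sum_congr rfl h1, Finset.sum_comm]
  have h2 : ∀ m ∈ s.prodPrimes.divisors.filter (· ≤ R),
      (∑ d ∈ s.prodPrimes.divisors, (s.selbergSum R)⁻¹ * s.selbergTerms m *
        if d ∣ m ∧ l ∣ d then (μ d : ℝ) else 0) =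
      if m = l then (s.selbergSum R)⁻¹ * (μ l : ℝ) * s.selbergTerms l else 0 := by
    intro m hm
    simp only [mem_filter] at hm
    have hmP := Nat.dvd_of_mem_divisors hm.1
    rw [← Finset.mul_sum, ← Finset.sum_filter, ← filter_filter,
      Nat.divisors_filter_dvd_of_dvd prodPrimes_ne_zero hmP]
    by_cases hlm : l ∣ m
    · rw [sum_moebius_between (squarefree_of_dvd_prodPrimes hmP) hlm]
      by_cases h : l = m
      · subst h; simp; ring
      · simp [h, Ne.symm h]
    · have : ¬ m = l := by rintro rfl; exact hlm dvd_rfl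
      rw [if_neg this, Finset.sum_eq_zero, mul_zero]
      · exact fun d hd => absurd ((mem_filter.1 hd).2.trans
          (Nat.dvd_of_mem_divisors (mem_filter.1 hd).1)) hlm
  rw [Finset.sum_congr rfl h2, Finset.sum_ite_eq']
  simp [hl, prodPrimes_ne_zero]

theorem mainSum_selbergWeight {R : ℕ} (hR : 1 ≤ R) :
    s.mainSum (lambdaSquared (s.selbergWeight R)) = (s.selbergSum R)⁻¹ := by
  have hG := (selbergSum_pos (s := s) hR).ne'
  rw [mainSum_lambdaSquared_eq_sum_mul_sum_sq]
  have : ∀ l ∈ s.prodPrimes.divisors, (s.selbergTerms l)⁻¹ *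
      (∑ d ∈ s.prodPrimes.divisors, if l ∣ d then s.nu d * s.selbergWeight R d else 0) ^ 2 =
      if l ≤ R then (s.selbergSum R)⁻¹ ^ 2 * s.selbergTerms l else 0 := by
    intro l hl
    have hlP := Nat.dvd_of_mem_divisors hl
    have hg := (selbergTerms_pos hlP).ne'
    rw [sum_nu_mul_selbergWeight hlP]
    split_ifs
    · have hmu : (μ l : ℝ) ^ 2 = 1 := by
        exact_mod_cast moebius_sq_eq_one_of_squarefree (squarefree_of_dvd_prodPrimes hlP)
      rw [mul_pow, mul_pow, hmu]
      field_simp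
    · simp
  rw [Finset.sum_congr rfl this, ← Finset.sum_filter, ← Finset.mul_sum, ← selbergSum]
  field_simp

/-- The Selberg weights are bounded by `1`: the products `k (l / d)` with `k ∣ d ∣ l ≤ R` are
distinct divisors of `P` that do not exceed `R`. -/
theorem abs_selbergWeight_le_one {R d : ℕ} (hR : 1 ≤ R) (hd : d ∣ s.prodPrimes) :
    |s.selbergWeight R d| ≤ 1 := by
  have hG := selbergSum_pos (s := s) hR
  have hnu := nu_pos_of_dvd_prodPrimes hd
  have hd0 : 0 < d := Nat.pos_of_ne_zero (ne_zero_of_dvd_ne_zero prodPrimes_ne_zero hd)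
  have hgd := selbergTerms_pos hd
  set S := ∑ l ∈ s.prodPrimes.divisors with l ≤ R ∧ d ∣ l, s.selbergTerms l with hS
  have hS0 : 0 ≤ S := Finset.sum_nonneg fun l hl =>
    (selbergTerms_pos (Nat.dvd_of_mem_divisors (mem_filter.1 hl).1)).le
  have key : (s.nu d)⁻¹ * S ≤ s.selbergSum R := by
    have h1 : (s.nu d)⁻¹ = (s.selbergTerms d)⁻¹ * ∑ k ∈ d.divisors, s.selbergTerms k := by
      have := sum_divisors_selbergTerms_eq_selbergTerms_mul_nu_inv hd
      rw [← sum_filter, Nat.divisors_filter_dvd_of_dvd prodPrimes_ne_zero hd] at this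
      rw [this]
      field_simp
    have hmul : ∀ k ∈ d.divisors, ∀ l ∈ s.prodPrimes.divisors.filter (fun l => l ≤ R ∧ d ∣ l),
        (s.selbergTerms d)⁻¹ * s.selbergTerms k * s.selbergTerms l =
          s.selbergTerms (k * (l / d)) ∧ k * (l / d) ∈ s.prodPrimes.divisors.filter (· ≤ R) ∧
          (k * (l / d)).gcd d = k := by
      intro k hk l hl
      simp only [mem_filter, Nat.mem_divisors] at hk hl
      obtain ⟨m, rfl⟩ := hl.2.2
      rw [Nat.mul_div_cancel_left _ hd0]
      have hsq := squarefree_of_dvd_prodPrimes hl.1.1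
      have hc := (Nat.squarefree_mul_iff.1 hsq).1
      have hck : k.Coprime m := hc.coprime_dvd_left hk.1
      refine ⟨?_, ?_, ?_⟩
      · rw [selbergTerms_isMultiplicative.map_mul_of_coprime hc,
          selbergTerms_isMultiplicative.map_mul_of_coprime hck]
        field_simp
      · simp only [mem_filter, Nat.mem_divisors]
        refine ⟨⟨(Nat.mul_dvd_mul_right hk.1 m).trans hl.1.1, hl.1.2⟩, ?_⟩
        exact (Nat.mul_le_mul_right m (Nat.le_of_dvd hd0 hk.1)).trans hl.2.1
      · rw [Nat.Coprime.gcd_mul_right_cancel _ hc.symm, Nat.gcd_eq_left hk.1]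
    set T := s.prodPrimes.divisors.filter (fun l => l ≤ R ∧ d ∣ l) with hT
    set v₀ : ℕ × ℕ → ℕ := fun x => x.1 * (x.2 / d)
    have hinj : Set.InjOn v₀ (d.divisors ×ˢ T : Finset (ℕ × ℕ)) := by
      rintro ⟨k, l⟩ hx ⟨k', l'⟩ hx' heq
      simp only [coe_product, Set.mem_prod, mem_coe] at hx hx'
      have hkk : k = k' := by
        rw [← (hmul k hx.1 l hx.2).2.2, ← (hmul k' hx'.1 l' hx'.2).2.2]
        exact congrArg (fun v => v.gcd d) heq
      subst hkk
      have hk0 := Nat.pos_of_mem_divisors hx.1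
      have hl := (mem_filter.1 hx.2).2.2
      have hl' := (mem_filter.1 hx'.2).2.2
      have h3 : l / d = l' / d := Nat.eq_of_mul_eq_mul_left hk0 heq
      rw [Prod.mk.injEq]
      exact ⟨rfl, by rw [← Nat.div_mul_cancel hl, ← Nat.div_mul_cancel hl', h3]⟩
    calc (s.nu d)⁻¹ * S
        = ∑ x ∈ d.divisors ×ˢ T, (s.selbergTerms d)⁻¹ * s.selbergTerms x.1 *
            s.selbergTerms x.2 := by
          rw [h1, hS, mul_assoc, Finset.sum_mul_sum, Finset.mul_sum, Finset.sum_product]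
          simp only [Finset.mul_sum, mul_assoc]
      _ = ∑ x ∈ d.divisors ×ˢ T, s.selbergTerms (v₀ x) := by
          refine Finset.sum_congr rfl fun x hx => ?_
          rw [mem_product] at hx
          exact (hmul x.1 hx.1 x.2 hx.2).1
      _ = ∑ v ∈ (d.divisors ×ˢ T).image v₀, s.selbergTerms v := (Finset.sum_image hinj).symm
      _ ≤ s.selbergSum R := by
          refine Finset.sum_le_sum_of_subset_of_nonneg ?_ fun l hl _ =>
            (selbergTerms_pos (Nat.dvd_of_mem_divisors (mem_filter.1 hl).1)).le
          intro v hv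
          obtain ⟨x, hx, rfl⟩ := mem_image.1 hv
          rw [mem_product] at hx
          exact (hmul x.1 hx.1 x.2 hx.2).2.1
  rw [selbergWeight, ← hS, abs_mul, abs_mul, abs_mul, abs_of_pos (inv_pos.2 hnu),
    abs_of_pos (inv_pos.2 hG), abs_of_nonneg hS0]
  have hmu : |(μ d : ℝ)| ≤ 1 := by exact_mod_cast abs_moebius_le_one
  calc (s.nu d)⁻¹ * |(μ d : ℝ)| * (s.selbergSum R)⁻¹ * S
      = |(μ d : ℝ)| * (s.selbergSum R)⁻¹ * ((s.nu d)⁻¹ * S) := by ring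
    _ ≤ 1 * (s.selbergSum R)⁻¹ * s.selbergSum R := by gcongr
    _ = 1 := by field_simp

/-- The Selberg upper bound sieve: the main term is the reciprocal of the Selberg sum, and every
pair of divisors up to `R` contributes at most one remainder. -/
theorem siftedSum_le_selberg {R : ℕ} (hR : 1 ≤ R) :
    s.siftedSum ≤ s.totalMass * (s.selbergSum R)⁻¹ +
      ∑ d₁ ∈ s.prodPrimes.divisors with d₁ ≤ R, ∑ d₂ ∈ s.prodPrimes.divisors with d₂ ≤ R,
        |s.rem (d₁.lcm d₂)| := by
  have h := siftedSum_le_mainSum_errSum_of_upperMoebius (s := s) _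
    (upperMoebius_lambdaSquared _ (selbergWeight_one (s := s) hR))
  rw [mainSum_selbergWeight hR] at h
  refine h.trans (add_le_add le_rfl ?_)
  set w := s.selbergWeight R
  have hw : ∀ d ∈ s.prodPrimes.divisors, |w d| ≤ if d ≤ R then 1 else 0 := by
    intro d hd
    split_ifs with h
    · exact abs_selbergWeight_le_one hR (Nat.dvd_of_mem_divisors hd)
    · simp [w, selbergWeight_eq_zero (not_le.1 h)]
  calc s.errSum (lambdaSquared w)
      ≤ ∑ d ∈ s.prodPrimes.divisors, ∑ d₁ ∈ s.prodPrimes.divisors, ∑ d₂ ∈ s.prodPrimes.divisors,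
          if d = d₁.lcm d₂ then |w d₁| * |w d₂| * |s.rem d| else 0 := by
        refine Finset.sum_le_sum fun d hd => ?_
        have hsub := Nat.divisors_subset_of_dvd prodPrimes_ne_zero (Nat.dvd_of_mem_divisors hd)
        have : |lambdaSquared w d| ≤ ∑ d₁ ∈ s.prodPrimes.divisors, ∑ d₂ ∈ s.prodPrimes.divisors,
            if d = d₁.lcm d₂ then |w d₁| * |w d₂| else 0 := by
          have hnn : ∀ a b : ℕ, 0 ≤ if d = a.lcm b then |w a| * |w b| else 0 := by
            intro a b; split_ifs <;> positivity
          calc |lambdaSquared w d| ≤ ∑ d₁ ∈ d.divisors, ∑ d₂ ∈ d.divisors,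
                if d = d₁.lcm d₂ then |w d₁| * |w d₂| else 0 := by
                refine (abs_sum_le_sum_abs _ _).trans (Finset.sum_le_sum fun a _ => ?_)
                refine (abs_sum_le_sum_abs _ _).trans (Finset.sum_le_sum fun b _ => ?_)
                split_ifs <;> simp [abs_mul]
            _ ≤ ∑ d₁ ∈ d.divisors, ∑ d₂ ∈ s.prodPrimes.divisors,
                if d = d₁.lcm d₂ then |w d₁| * |w d₂| else 0 :=
                Finset.sum_le_sum fun a _ => Finset.sum_le_sum_of_subset_of_nonneg hsub
                  fun b _ _ => hnn a b
            _ ≤ _ := Finset.sum_le_sum_of_subset_of_nonneg hsub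
                  fun a _ _ => Finset.sum_nonneg fun b _ => hnn a b
        calc _ ≤ (∑ d₁ ∈ s.prodPrimes.divisors, ∑ d₂ ∈ s.prodPrimes.divisors,
            if d = d₁.lcm d₂ then |w d₁| * |w d₂| else 0) * |s.rem d| := by gcongr
          _ = _ := by simp only [Finset.sum_mul, ite_mul, zero_mul]
    _ = ∑ d₁ ∈ s.prodPrimes.divisors, ∑ d₂ ∈ s.prodPrimes.divisors,
          |w d₁| * |w d₂| * |s.rem (d₁.lcm d₂)| := by
        rw [Finset.sum_comm]
        refine Finset.sum_congr rfl fun a ha => ?_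
        rw [Finset.sum_comm]
        refine Finset.sum_congr rfl fun b hb => ?_
        rw [Finset.sum_ite_eq', if_pos]
        rw [Nat.mem_divisors] at ha hb ⊢
        exact ⟨Nat.lcm_dvd ha.1 hb.1, ha.2⟩
    _ ≤ ∑ d₁ ∈ s.prodPrimes.divisors, ∑ d₂ ∈ s.prodPrimes.divisors,
          (if d₁ ≤ R then 1 else 0) * (if d₂ ≤ R then 1 else 0) * |s.rem (d₁.lcm d₂)| := by
        refine Finset.sum_le_sum fun a ha => Finset.sum_le_sum fun b hb => ?_
        have := hw a ha
        have := hw b hb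
        gcongr
    _ = _ := by
        rw [Finset.sum_filter]
        refine Finset.sum_congr rfl fun a _ => ?_
        split_ifs
        · simp [Finset.sum_filter]
        · simp

end BoundingSieve

/-! ### Sums of the `r`-fold divisor function -/

namespace PrimeMoments

open Finset ArithmeticFunction

/-- The arithmetic function `n ↦ 1 / n`. Its `r`-th Dirichlet power is `n ↦ τ_r(n) / n`, where
`τ_r` is the `r`-fold divisor function. -/
noncomputable def recip : ArithmeticFunction ℝ := ⟨fun n => (n : ℝ)⁻¹, by simp⟩

theorem recip_apply (n : ℕ) : recip n = (n : ℝ)⁻¹ := rfl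

theorem isMultiplicative_recip : recip.IsMultiplicative := by
  refine ⟨by simp [recip_apply], fun {m n} _ => ?_⟩
  simp [recip_apply, mul_comm]

theorem isMultiplicative_recip_pow (r : ℕ) : (recip ^ r).IsMultiplicative :=
  isMultiplicative_recip.pow

theorem recip_pow_nonneg (r n : ℕ) : 0 ≤ (recip ^ r) n := by
  induction r generalizing n with
  | zero => rw [pow_zero, ArithmeticFunction.one_apply]; split_ifs <;> simp
  | succ r ih =>
    rw [pow_succ, ArithmeticFunction.mul_apply]
    exact Finset.sum_nonneg fun x _ => mul_nonneg (ih _) (by simp [recip_apply])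

/-- The sum `∑_{n ≤ X} τ_r(n) / n`. -/
noncomputable def divSum (r X : ℕ) : ℝ := ∑ n ∈ Ioc 0 X, (recip ^ r) n

theorem divSum_succ (r X : ℕ) :
    divSum (r + 1) X = ∑ n ∈ Ioc 0 X, (n : ℝ)⁻¹ * divSum r (X / n) := by
  rw [divSum, pow_succ', sum_Ioc_mul_eq_sum_sum]
  rfl

theorem divSum_zero {X : ℕ} (hX : 1 ≤ X) : divSum 0 X = 1 := by
  simp only [divSum, pow_zero, ArithmeticFunction.one_apply]
  rw [Finset.sum_ite_eq', if_pos (by simp; omega)]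

theorem divSum_mono (r : ℕ) {X Y : ℕ} (h : X ≤ Y) : divSum r X ≤ divSum r Y :=
  Finset.sum_le_sum_of_subset_of_nonneg (Ioc_subset_Ioc_right h)
    fun n _ _ => recip_pow_nonneg r n

theorem divSum_le (r : ℕ) {X : ℕ} (hX : 1 ≤ X) : divSum r X ≤ (1 + Real.log X) ^ r := by
  induction r with
  | zero => simp [divSum_zero hX]
  | succ r ih =>
    have hh : ∑ n ∈ Ioc 0 X, (n : ℝ)⁻¹ ≤ 1 + Real.log X := by
      have := harmonic_le_one_add_log X
      rw [harmonic_eq_sum_Icc] at this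
      push_cast at this
      exact this
    have h0 : 0 ≤ 1 + Real.log X := by
      have := Real.log_nonneg (x := (X : ℝ)) (by exact_mod_cast hX)
      linarith
    rw [divSum_succ]
    calc ∑ n ∈ Ioc 0 X, (n : ℝ)⁻¹ * divSum r (X / n)
        ≤ ∑ n ∈ Ioc 0 X, (n : ℝ)⁻¹ * (1 + Real.log X) ^ r := by
          refine Finset.sum_le_sum fun n _ => ?_
          have := (divSum_mono r (Nat.div_le_self X n)).trans ih
          gcongr
      _ = (∑ n ∈ Ioc 0 X, (n : ℝ)⁻¹) * (1 + Real.log X) ^ r := by rw [Finset.sum_mul]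
      _ ≤ (1 + Real.log X) * (1 + Real.log X) ^ r := by gcongr
      _ = _ := by ring

theorem pow_succ_sub_pow_succ_le {a b : ℝ} (hb : 0 ≤ b) (hab : b ≤ a) (r : ℕ) :
    a ^ (r + 1) - b ^ (r + 1) ≤ (r + 1) * (a - b) * a ^ r := by
  induction r with
  | zero => simp
  | succ r ih =>
    have ha : 0 ≤ a := hb.trans hab
    have h1 : b ^ (r + 1) ≤ a ^ (r + 1) := by gcongr
    have h2 : a ^ (r + 1 + 1) - b ^ (r + 1 + 1) =
      a * (a ^ (r + 1) - b ^ (r + 1)) + (a - b) * b ^ (r + 1) := by ring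
    rw [h2]
    calc _ ≤ a * ((r + 1) * (a - b) * a ^ r) + (a - b) * a ^ (r + 1) := by
          have : 0 ≤ a - b := by linarith
          gcongr
      _ = _ := by push_cast; ring

/-- The lower bound comes from comparing the sum with the volume of a simplex: the increments of
`u ↦ log((X+1)/u)^{r+1}` telescope. -/
theorem log_pow_div_factorial_le_divSum (r : ℕ) {X : ℕ} (hX : 1 ≤ X) :
    Real.log (X + 1) ^ r / r.factorial ≤ divSum r X := by
  induction r generalizing X with
  | zero => simp [divSum_zero hX]
  | succ r ih =>
    set F : ℕ → ℝ := fun n => Real.log ((X + 1) / (n + 1)) ^ (r + 1) with hF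
    have hfac : (0 : ℝ) < r.factorial := by exact_mod_cast r.factorial_pos
    have hstep : ∀ n ∈ range X, (F n - F (n + 1)) / (r + 1).factorial ≤
        ((n + 1 : ℕ) : ℝ)⁻¹ * divSum r (X / (n + 1)) := by
      intro n hn
      have hnX : n + 1 ≤ X := by simpa using hn
      have hnX' : (n : ℝ) + 1 ≤ X := by exact_mod_cast hnX
      have hn0 : (0 : ℝ) < n + 1 := by positivity
      set a := Real.log ((X + 1) / (n + 1)) with ha
      set b := Real.log ((X + 1) / ((n + 1 : ℕ) + 1)) with hb
      have hb0 : 0 ≤ b := by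
        apply Real.log_nonneg
        rw [le_div_iff₀ (by positivity)]
        push_cast
        linarith
      have hab' : a - b = Real.log (1 + ((n : ℝ) + 1)⁻¹) := by
        rw [ha, hb, ← Real.log_div (by positivity) (by positivity)]
        congr 1
        push_cast
        field_simp
      have hab : a - b ≤ ((n : ℝ) + 1)⁻¹ := by
        rw [hab']
        have := Real.log_le_sub_one_of_pos (x := 1 + ((n : ℝ) + 1)⁻¹) (by positivity)
        linarith
      have hab0 : 0 ≤ a - b := by
        rw [hab']
        apply Real.log_nonneg
        have : 0 < ((n : ℝ) + 1)⁻¹ := by positivity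
        linarith
      have ha0 : 0 ≤ a := by linarith
      have h1 := pow_succ_sub_pow_succ_le hb0 (by linarith : b ≤ a) r
      have hdiv : 1 ≤ X / (n + 1) := (Nat.one_le_div_iff (by omega)).2 hnX
      have hlog : a ≤ Real.log ((X / (n + 1) : ℕ) + 1) := by
        apply Real.log_le_log (by positivity)
        rw [div_le_iff₀ hn0]
        have : X + 1 ≤ (X / (n + 1) + 1) * (n + 1) := by
          have := Nat.lt_div_mul_add (a := X) (b := n + 1) (by omega)
          nlinarith
        exact_mod_cast this
      have h2 := ih hdiv
      calc (F n - F (n + 1)) / (r + 1).factorial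
          ≤ ((r + 1) * (a - b) * a ^ r) / (r + 1).factorial := by
            gcongr
        _ = (a - b) * (a ^ r / r.factorial) := by
            rw [Nat.factorial_succ]; push_cast; field_simp
        _ ≤ ((n : ℝ) + 1)⁻¹ * (Real.log ((X / (n + 1) : ℕ) + 1) ^ r / r.factorial) := by
            gcongr
        _ ≤ ((n : ℝ) + 1)⁻¹ * divSum r (X / (n + 1)) := by gcongr
        _ = _ := by push_cast; rfl
    have hsum := Finset.sum_le_sum hstep
    rw [← Finset.sum_div, Finset.sum_range_sub', divSum_succ] at *
    have hre : ∑ n ∈ Ioc 0 X, (n : ℝ)⁻¹ * divSum r (X / n) =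
        ∑ n ∈ range X, ((n + 1 : ℕ) : ℝ)⁻¹ * divSum r (X / (n + 1)) := by
      rw [Finset.range_eq_Ico, Finset.sum_Ico_add' (fun n : ℕ => (n : ℝ)⁻¹ * divSum r (X / n)) 0 X 1]
      rfl
    rw [hre]
    refine le_trans (le_of_eq ?_) hsum
    have hX1 : (X : ℝ) + 1 ≠ 0 := by positivity
    simp [hF, div_self hX1]

theorem mul_apply_prime_pow (f g : ArithmeticFunction ℝ) {p : ℕ} (hp : p.Prime) (j : ℕ) :
    (f * g) (p ^ j) = ∑ x ∈ antidiagonal j, f (p ^ x.1) * g (p ^ x.2) := by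
  rw [ArithmeticFunction.mul_apply, Nat.sum_divisorsAntidiagonal (f := fun a b => f a * g b),
    Nat.sum_divisors_prime_pow hp, Finset.Nat.sum_antidiagonal_eq_sum_range_succ_mk]
  refine Finset.sum_congr rfl fun i hi => ?_
  rw [Nat.pow_div (by simpa [Nat.lt_succ_iff] using hi) hp.pos]

theorem recip_pow_prime (r : ℕ) {p : ℕ} (hp : p.Prime) : (recip ^ r) p = r / p := by
  induction r with
  | zero => simp [hp.ne_one]
  | succ r ih =>
    have h := mul_apply_prime_pow (recip ^ r) recip hp 1
    rw [pow_one] at h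
    rw [pow_succ, h, Finset.Nat.sum_antidiagonal_eq_sum_range_succ_mk]
    simp only [Finset.sum_range_succ, Finset.sum_range_zero, Nat.sub_zero, Nat.sub_self, pow_one,
      pow_zero, ih, (isMultiplicative_recip_pow r).map_one,
      recip_apply]
    push_cast
    ring

theorem recip_pow_of_squarefree (r : ℕ) {d : ℕ} (hd : Squarefree d) :
    (recip ^ r) d = (r : ℝ) ^ #d.primeFactors / d := by
  have h := (isMultiplicative_recip_pow r).map_prod_of_subset_primeFactors d _ subset_rfl
  rw [Nat.prod_primeFactors_of_squarefree hd] at h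
  rw [h, Finset.prod_congr rfl fun p hp => recip_pow_prime r (Nat.prime_of_mem_primeFactors hp),
    Finset.prod_div_distrib, Finset.prod_const]
  congr 1
  rw [← Nat.cast_prod, Nat.prod_primeFactors_of_squarefree hd]

/-- Partial sums of the expansion of the local Euler factor of `ζ(s) ^ r` at `s = 1`. -/
theorem sum_recip_pow_prime_pow_le (r J : ℕ) {p : ℕ} (hp : p.Prime) :
    ∑ j ∈ range J, (recip ^ r) (p ^ j) ≤ (1 - (p : ℝ)⁻¹)⁻¹ ^ r := by
  have hp1 : (p : ℝ)⁻¹ < 1 := inv_lt_one_of_one_lt₀ (by exact_mod_cast hp.one_lt)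
  have hp0 : 0 ≤ (p : ℝ)⁻¹ := by positivity
  induction r with
  | zero =>
    simp only [pow_zero]
    rcases J with _ | J
    · simp
    · rw [Finset.sum_range_succ']
      rw [Finset.sum_eq_zero]
      · simp
      · intro j _
        rw [ArithmeticFunction.one_apply, if_neg]
        exact (Nat.one_lt_pow (by omega) hp.one_lt).ne'
  | succ r ih =>
    have hgeom : ∑ j ∈ range J, recip (p ^ j) ≤ (1 - (p : ℝ)⁻¹)⁻¹ := by
      have : ∀ j, recip (p ^ j) = ((p : ℝ)⁻¹) ^ j := fun j => by simp [recip_apply]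
      simp only [this]
      rw [← tsum_geometric_of_lt_one hp0 hp1]
      exact (summable_geometric_of_lt_one hp0 hp1).sum_le_tsum _ fun _ _ => by positivity
    calc ∑ j ∈ range J, (recip ^ (r + 1)) (p ^ j)
        = ∑ j ∈ range J, ∑ x ∈ antidiagonal j, (recip ^ r) (p ^ x.1) * recip (p ^ x.2) := by
          refine Finset.sum_congr rfl fun j _ => ?_
          rw [pow_succ, mul_apply_prime_pow _ _ hp]
      _ = ∑ x ∈ (range J).sigma (fun j => antidiagonal j),
            (recip ^ r) (p ^ x.2.1) * recip (p ^ x.2.2) := by rw [Finset.sum_sigma]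
      _ = ∑ y ∈ ((range J).sigma (fun j => antidiagonal j)).image (fun x => x.2),
            (recip ^ r) (p ^ y.1) * recip (p ^ y.2) := by
          rw [Finset.sum_image]
          rintro ⟨j, a⟩ h ⟨j', a'⟩ h' heq
          simp only [coe_sigma, Set.mem_sigma_iff, mem_coe, HasAntidiagonal.mem_antidiagonal] at h h'
          obtain rfl : a = a' := heq
          obtain rfl : j = j' := h.2.symm.trans h'.2
          rfl
      _ ≤ ∑ y ∈ range J ×ˢ range J, (recip ^ r) (p ^ y.1) * recip (p ^ y.2) := by
          refine Finset.sum_le_sum_of_subset_of_nonneg ?_ fun y _ _ =>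
            mul_nonneg (recip_pow_nonneg _ _) (by simp [recip_apply])
          intro y hy
          simp only [mem_image, mem_sigma, HasAntidiagonal.mem_antidiagonal, mem_range, mem_product] at hy ⊢
          obtain ⟨x, ⟨h1, h2⟩, rfl⟩ := hy
          omega
      _ = (∑ j ∈ range J, (recip ^ r) (p ^ j)) * ∑ j ∈ range J, recip (p ^ j) := by
          rw [Finset.sum_mul_sum, Finset.sum_product]
      _ ≤ (1 - (p : ℝ)⁻¹)⁻¹ ^ r * (1 - (p : ℝ)⁻¹)⁻¹ := by
          have : 0 ≤ (1 - (p : ℝ)⁻¹)⁻¹ := inv_nonneg.2 (by linarith)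
          gcongr
          exact Finset.sum_nonneg fun _ _ => by simp [recip_apply]
      _ = _ := by ring

/-! ### Comparing the divisor sum with the Selberg sum -/

/-- The part of `∑_{n ≤ X} τ_r(n) / n` coming from the `n` all of whose prime factors lie
in `S`. -/
noncomputable def divSumOn (r : ℕ) (S : Finset ℕ) (X : ℕ) : ℝ :=
  ∑ n ∈ Ioc 0 X with n.primeFactors ⊆ S, (recip ^ r) n

theorem divSumOn_nonneg (r : ℕ) (S : Finset ℕ) (X : ℕ) : 0 ≤ divSumOn r S X :=
  Finset.sum_nonneg fun n _ => recip_pow_nonneg r n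

theorem divSumOn_mono (r : ℕ) (S : Finset ℕ) {X Y : ℕ} (h : X ≤ Y) :
    divSumOn r S X ≤ divSumOn r S Y :=
  Finset.sum_le_sum_of_subset_of_nonneg
    (Finset.filter_subset_filter _ (Ioc_subset_Ioc_right h)) fun n _ _ => recip_pow_nonneg r n

/-- Sorting the integers by their `p`-adic valuation. -/
theorem divSumOn_insert_le (r : ℕ) {S : Finset ℕ} {p : ℕ} (hp : p.Prime) (X : ℕ) :
    divSumOn r (insert p S) X ≤
      ∑ j ∈ range (X + 1), (recip ^ r) (p ^ j) * divSumOn r S (X / p ^ j) := by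
  set N := (Ioc 0 X).filter (fun n => n.primeFactors ⊆ insert p S) with hN
  have hmem : ∀ n ∈ N, n.factorization p ∈ range (X + 1) := by
    intro n hn
    simp only [hN, mem_filter, mem_Ioc, mem_range] at hn ⊢
    have := Nat.factorization_lt p (by omega : n ≠ 0)
    omega
  rw [divSumOn, ← hN, ← Finset.sum_fiberwise_of_maps_to hmem]
  refine Finset.sum_le_sum fun j _ => ?_
  rw [divSumOn, Finset.mul_sum]
  have hpj : 0 < p ^ j := pow_pos hp.pos j
  calc ∑ n ∈ N with n.factorization p = j, (recip ^ r) n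
      = ∑ n ∈ N with n.factorization p = j, (recip ^ r) (p ^ j) * (recip ^ r) (n / p ^ j) := by
        refine Finset.sum_congr rfl fun n hn => ?_
        simp only [hN, mem_filter, mem_Ioc] at hn
        obtain ⟨⟨hn0, -⟩, rfl⟩ := hn
        have hc := (Nat.coprime_ordCompl hp (by omega : n ≠ 0)).pow_left (n.factorization p)
        rw [← (isMultiplicative_recip_pow r).map_mul_of_coprime hc, Nat.ordProj_mul_ordCompl_eq_self]
    _ = ∑ m ∈ (N.filter (fun n => n.factorization p = j)).image (fun n => n / p ^ j),
          (recip ^ r) (p ^ j) * (recip ^ r) m := by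
        rw [Finset.sum_image]
        intro a ha b hb hab
        simp only [hN, coe_filter, mem_filter, Set.mem_ofPred_eq] at ha hb
        have h1 : p ^ j ∣ a := ha.2 ▸ Nat.ordProj_dvd a p
        have h2 : p ^ j ∣ b := hb.2 ▸ Nat.ordProj_dvd b p
        rw [← Nat.mul_div_cancel' h1, ← Nat.mul_div_cancel' h2]
        exact congrArg _ hab
    _ ≤ _ := by
        refine Finset.sum_le_sum_of_subset_of_nonneg ?_ fun m _ _ =>
          mul_nonneg (recip_pow_nonneg _ _) (recip_pow_nonneg _ _)
        intro m hm
        simp only [hN, mem_image, mem_filter, mem_Ioc] at hm ⊢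
        obtain ⟨n, ⟨⟨⟨hn0, hnX⟩, hS⟩, rfl⟩, rfl⟩ := hm
        have hn0' : n ≠ 0 := by omega
        refine ⟨⟨Nat.ordCompl_pos p hn0', Nat.div_le_div_right hnX⟩, ?_⟩
        intro q hq
        have hq' := Nat.primeFactors_mono (Nat.ordCompl_dvd n p) hn0' hq
        rcases Finset.mem_insert.1 (hS hq') with rfl | h
        · exact absurd (Nat.dvd_of_mem_primeFactors hq) (Nat.not_dvd_ordCompl hp hn0')
        · exact h

theorem divSumOn_insert_le_mul (r : ℕ) {S : Finset ℕ} {p : ℕ} (hp : p.Prime) (X : ℕ) :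
    divSumOn r (insert p S) X ≤ (1 - (p : ℝ)⁻¹)⁻¹ ^ r * divSumOn r S X := by
  refine (divSumOn_insert_le r hp X).trans ?_
  calc _ ≤ ∑ j ∈ range (X + 1), (recip ^ r) (p ^ j) * divSumOn r S X := by
        refine Finset.sum_le_sum fun j _ => mul_le_mul_of_nonneg_left
          (divSumOn_mono r S (Nat.div_le_self _ _)) (recip_pow_nonneg _ _)
    _ = (∑ j ∈ range (X + 1), (recip ^ r) (p ^ j)) * divSumOn r S X := by rw [Finset.sum_mul]
    _ ≤ _ := mul_le_mul_of_nonneg_right (sum_recip_pow_prime_pow_le r _ hp) (divSumOn_nonneg _ _ _)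

theorem divSumOn_union_le (r : ℕ) {Q : Finset ℕ} (hQ : ∀ p ∈ Q, p.Prime) (S : Finset ℕ) (X : ℕ) :
    divSumOn r (Q ∪ S) X ≤ (∏ p ∈ Q, (1 - (p : ℝ)⁻¹)⁻¹ ^ r) * divSumOn r S X := by
  induction Q using Finset.induction_on with
  | empty => simp
  | insert p Q hpQ ih =>
    have hp := hQ p (mem_insert_self _ _)
    have hp1 : (p : ℝ)⁻¹ < 1 := inv_lt_one_of_one_lt₀ (by exact_mod_cast hp.one_lt)
    have h0 : 0 ≤ (1 - (p : ℝ)⁻¹)⁻¹ ^ r := pow_nonneg (inv_nonneg.2 (by linarith)) r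
    rw [Finset.insert_union, Finset.prod_insert hpQ, mul_assoc]
    exact (divSumOn_insert_le_mul r hp X).trans
      (mul_le_mul_of_nonneg_left (ih fun q hq => hQ q (mem_insert_of_mem hq)) h0)

theorem divSumOn_empty (r X : ℕ) : divSumOn r ∅ X = if 1 ≤ X then 1 else 0 := by
  have : (Ioc 0 X).filter (fun n => n.primeFactors ⊆ ∅) = if 1 ≤ X then {1} else ∅ := by
    ext n
    simp only [mem_filter, mem_Ioc, subset_empty, Nat.primeFactors_eq_empty]
    split_ifs
    · simp; omega
    · simp; omega
  rw [divSumOn, this]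
  split_ifs
  · simp [(isMultiplicative_recip_pow r).map_one]
  · simp

/-- The Selberg sum for the density `r / p` at each of the primes of `S`, as a sum over sets of
primes. -/
noncomputable def primeSetSum (r : ℕ) (S : Finset ℕ) (X : ℕ) : ℝ :=
  ∑ U ∈ S.powerset with ∏ p ∈ U, p ≤ X, ∏ p ∈ U, ((r : ℝ) / (p - r))

/-- The local factors compare by Bernoulli's inequality `1 - r / p ≤ (1 - 1 / p) ^ r`. -/
theorem divSumOn_le_primeSetSum (r : ℕ) {S : Finset ℕ} (hS : ∀ p ∈ S, p.Prime ∧ r < p) (X : ℕ) :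
    divSumOn r S X ≤ primeSetSum r S X := by
  induction S using Finset.induction_on generalizing X with
  | empty =>
    rw [divSumOn_empty, primeSetSum, Finset.powerset_empty, Finset.sum_filter]
    simp
  | insert p S hpS ih =>
    obtain ⟨hp, hrp⟩ := hS p (mem_insert_self _ _)
    have ih' := fun X => ih (fun q hq => hS q (mem_insert_of_mem hq)) X
    have hp0 : (0 : ℝ) < p := by exact_mod_cast hp.pos
    have hrp' : (r : ℝ) < p := by exact_mod_cast hrp
    have hp1 : (p : ℝ)⁻¹ < 1 := inv_lt_one_of_one_lt₀ (by exact_mod_cast hp.one_lt)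
    have hbern : (1 - (p : ℝ)⁻¹)⁻¹ ^ r ≤ 1 + (r : ℝ) / (p - r) := by
      have h1 : 1 - (r : ℝ) / p ≤ (1 - (p : ℝ)⁻¹) ^ r := by
        have := one_add_mul_le_pow (a := -(p : ℝ)⁻¹) (by linarith) r
        rw [← sub_eq_add_neg] at this
        calc _ = 1 + (r : ℝ) * -(p : ℝ)⁻¹ := by ring
          _ ≤ _ := this
      have h2 : 0 < 1 - (r : ℝ) / p := by rw [sub_pos, div_lt_one hp0]; exact hrp'
      have h3 : (0 : ℝ) < p - r := by linarith
      rw [inv_pow]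
      calc ((1 - (p : ℝ)⁻¹) ^ r)⁻¹ ≤ (1 - (r : ℝ) / p)⁻¹ := inv_anti₀ h2 h1
        _ = _ := by
          rw [one_add_div h3.ne', one_sub_div hp0.ne', inv_div]
          congr 1
          ring
    have hrec : primeSetSum r (insert p S) X =
        primeSetSum r S X + (r : ℝ) / (p - r) * primeSetSum r S (X / p) := by
      rw [primeSetSum, Finset.sum_filter, Finset.sum_powerset_insert hpS, primeSetSum,
        Finset.sum_filter, primeSetSum, Finset.sum_filter, Finset.mul_sum]
      congr 1
      refine Finset.sum_congr rfl fun U hU => ?_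
      have hpU : p ∉ U := fun h => hpS (mem_powerset.1 hU h)
      rw [Finset.prod_insert hpU, Finset.prod_insert hpU]
      simp only [Nat.le_div_iff_mul_le hp.pos, mul_comm p, mul_ite, mul_zero]
    rw [hrec]
    refine (divSumOn_insert_le r hp X).trans ?_
    rw [Finset.sum_range_succ']
    have h0 : (recip ^ r) (p ^ 0) * divSumOn r S (X / p ^ 0) = divSumOn r S X := by
      simp [(isMultiplicative_recip_pow r).map_one]
    rw [h0, add_comm]
    refine add_le_add (ih' X) ?_
    -- Terms with `j ≥ 1` are bounded using `X / p ^ j ≤ X / p`, which turns their total weight into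
    -- the local Euler factor minus `1`.
    calc ∑ j ∈ range X, (recip ^ r) (p ^ (j + 1)) * divSumOn r S (X / p ^ (j + 1))
        ≤ ∑ j ∈ range X, (recip ^ r) (p ^ (j + 1)) * divSumOn r S (X / p) := by
          refine Finset.sum_le_sum fun j _ => mul_le_mul_of_nonneg_left
            (divSumOn_mono r S ?_) (recip_pow_nonneg _ _)
          exact Nat.div_le_div_left (Nat.le_self_pow (by omega) p) hp.pos
      _ = (∑ j ∈ range X, (recip ^ r) (p ^ (j + 1))) * divSumOn r S (X / p) := by
          rw [Finset.sum_mul]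
      _ ≤ (r : ℝ) / (p - r) * divSumOn r S (X / p) := by
          refine mul_le_mul_of_nonneg_right ?_ (divSumOn_nonneg _ _ _)
          have := sum_recip_pow_prime_pow_le r (X + 1) hp
          rw [Finset.sum_range_succ', pow_zero, (isMultiplicative_recip_pow r).map_one] at this
          linarith
      _ ≤ _ := by
          refine mul_le_mul_of_nonneg_left (ih' _) (div_nonneg (by positivity) (by linarith))

/-- A lower bound for the Selberg sum in which the sieving primes are all the primes up to `X`
outside `Q`. -/
theorem log_pow_le_primeSetSum (r : ℕ) {X : ℕ} (hX : 1 ≤ X) {Q S : Finset ℕ}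
    (hQ : ∀ p ∈ Q, p.Prime) (hS : ∀ p ∈ S, p.Prime ∧ r < p)
    (hQS : ∀ p, p.Prime → p ≤ X → p ∈ Q ∨ p ∈ S) :
    Real.log (X + 1) ^ r / r.factorial ≤
      (∏ p ∈ Q, (1 - (p : ℝ)⁻¹)⁻¹ ^ r) * primeSetSum r S X := by
  have h0 : 0 ≤ ∏ p ∈ Q, (1 - (p : ℝ)⁻¹)⁻¹ ^ r := Finset.prod_nonneg fun p hp => by
    have hp1 : (p : ℝ)⁻¹ < 1 := inv_lt_one_of_one_lt₀ (by exact_mod_cast (hQ p hp).one_lt)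
    exact pow_nonneg (inv_nonneg.2 (by linarith)) r
  refine (log_pow_div_factorial_le_divSum r hX).trans (le_trans (le_of_eq ?_)
    ((divSumOn_union_le r hQ S X).trans
      (mul_le_mul_of_nonneg_left (divSumOn_le_primeSetSum r hS X) h0)))
  rw [divSum, divSumOn, Finset.filter_true_of_mem]
  intro n hn p hp
  rw [mem_Ioc] at hn
  rw [mem_union]
  exact hQS p (Nat.prime_of_mem_primeFactors hp) ((Nat.le_of_mem_primeFactors hp).trans hn.2)

end PrimeMoments

/-! ### Sieving a product of linear forms -/

namespace PrimeMoments

open Finset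

/-- The product of linear forms `∏ᵢ (aᵢ + W m)`. -/
def linProd {r : ℕ} (a : Fin r → ℕ) (W m : ℕ) : ℕ := ∏ i, (a i + W * m)

theorem dvd_linProd_iff_of_modEq {r : ℕ} (a : Fin r → ℕ) (W : ℕ) {d m m' : ℕ}
    (h : m ≡ m' [MOD d]) : d ∣ linProd a W m ↔ d ∣ linProd a W m' := by
  have h' : (m : ZMod d) = m' := (ZMod.natCast_eq_natCast_iff _ _ _).2 h
  rw [← ZMod.natCast_eq_zero_iff, ← ZMod.natCast_eq_zero_iff, linProd, linProd]
  push_cast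
  rw [h']

/-- The number of residue classes `m` modulo `d` with `d ∣ ∏ᵢ (aᵢ + W m)`. -/
def rootCount {r : ℕ} (a : Fin r → ℕ) (W d : ℕ) : ℕ := #{m ∈ range d | d ∣ linProd a W m}

theorem rootCount_mul {r : ℕ} (a : Fin r → ℕ) (W : ℕ) {d e : ℕ} (hd : d ≠ 0) (he : e ≠ 0)
    (h : d.Coprime e) : rootCount a W (d * e) = rootCount a W d * rootCount a W e := by
  rw [rootCount, rootCount, rootCount, ← Finset.card_product]
  refine Finset.card_bij' (fun m _ => (m % d, m % e))
    (fun x _ => (Nat.chineseRemainder h x.1 x.2 : ℕ)) ?_ ?_ ?_ ?_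
  · intro m hm
    simp only [mem_filter, mem_range, mem_product] at hm ⊢
    exact ⟨⟨Nat.mod_lt _ (Nat.pos_of_ne_zero hd), (dvd_linProd_iff_of_modEq a W
        (Nat.mod_modEq m d)).2 ((Nat.dvd_mul_right d e).trans hm.2)⟩,
      ⟨Nat.mod_lt _ (Nat.pos_of_ne_zero he), (dvd_linProd_iff_of_modEq a W
        (Nat.mod_modEq m e)).2 ((Nat.dvd_mul_left e d).trans hm.2)⟩⟩
  · rintro ⟨x, y⟩ hx
    simp only [mem_filter, mem_range, mem_product] at hx ⊢
    have hk := (Nat.chineseRemainder h x y).2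
    exact ⟨Nat.chineseRemainder_lt_mul h x y hd he, h.mul_dvd_of_dvd_of_dvd
      ((dvd_linProd_iff_of_modEq a W hk.1).2 hx.1.2) ((dvd_linProd_iff_of_modEq a W hk.2).2 hx.2.2)⟩
  · intro m hm
    simp only [mem_filter, mem_range] at hm
    have hk := (Nat.chineseRemainder h (m % d) (m % e)).2
    refine Nat.ModEq.eq_of_lt_of_lt ?_ (Nat.chineseRemainder_lt_mul h _ _ hd he) hm.1
    exact (Nat.modEq_and_modEq_iff_modEq_mul h).1
      ⟨hk.1.trans (Nat.mod_modEq m d), hk.2.trans (Nat.mod_modEq m e)⟩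
  · rintro ⟨x, y⟩ hx
    simp only [mem_filter, mem_range, mem_product] at hx
    have hk := (Nat.chineseRemainder h x y).2
    rw [Prod.mk.injEq]
    exact ⟨Eq.trans hk.1 (Nat.mod_eq_of_lt hx.1.1), Eq.trans hk.2 (Nat.mod_eq_of_lt hx.2.1)⟩

theorem rootCount_prime {r : ℕ} (a : Fin r → ℕ) {W p : ℕ} (hp : p.Prime) (hW : ¬ p ∣ W)
    (ha : ∀ i j, i ≠ j → ¬ a i ≡ a j [MOD p]) : rootCount a W p = r := by
  have := Fact.mk hp
  have hW' : (W : ZMod p) ≠ 0 := by rwa [Ne, ZMod.natCast_eq_zero_iff]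
  set f : Fin r → ℕ := fun i => ((-(a i : ZMod p)) * (W : ZMod p)⁻¹).val with hf
  have hinj : Function.Injective f := by
    intro i j hij
    by_contra hne
    refine ha i j hne ((ZMod.natCast_eq_natCast_iff _ _ _).1 ?_)
    have := mul_right_cancel₀ (inv_ne_zero hW') (ZMod.val_injective p hij)
    exact neg_injective this
  have : (range p).filter (fun m => p ∣ linProd a W m) = univ.image f := by
    ext m
    simp only [mem_filter, mem_range, mem_image, mem_univ, true_and]
    constructor
    · rintro ⟨hm, hd⟩
      obtain ⟨i, -, hi⟩ := (Prime.dvd_finsetProd_iff hp.prime _).1 hd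
      refine ⟨i, ?_⟩
      rw [← ZMod.natCast_eq_zero_iff] at hi
      push_cast at hi
      have : (-(a i : ZMod p)) * (W : ZMod p)⁻¹ = (m : ZMod p) := by
        rw [eq_neg_of_add_eq_zero_left hi]
        field_simp
      rw [hf]
      simp only [this, ZMod.val_natCast, Nat.mod_eq_of_lt hm]
    · rintro ⟨i, rfl⟩
      refine ⟨ZMod.val_lt _, (Prime.dvd_finsetProd_iff hp.prime _).2 ⟨i, mem_univ _, ?_⟩⟩
      rw [← ZMod.natCast_eq_zero_iff]
      push_cast
      rw [hf]
      simp only [ZMod.natCast_val, ZMod.cast_id', id]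
      field_simp
      ring
  rw [rootCount, this, Finset.card_image_of_injective _ hinj, Finset.card_univ, Fintype.card_fin]

theorem rootCount_of_squarefree {r : ℕ} (a : Fin r → ℕ) {W d : ℕ} (hd : Squarefree d)
    (hW : ∀ p, p.Prime → p ∣ d → ¬ p ∣ W)
    (ha : ∀ p, p.Prime → p ∣ d → ∀ i j, i ≠ j → ¬ a i ≡ a j [MOD p]) :
    rootCount a W d = r ^ #d.primeFactors := by
  induction d using induction_on_primes with
  | zero => simp at hd
  | one => simp [rootCount]
  | prime_mul p d hp ih =>
    obtain ⟨hc, -, hd'⟩ := Nat.squarefree_mul_iff.1 hd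
    rw [rootCount_mul a W hp.ne_zero hd'.ne_zero hc, hc.primeFactors_mul,
      card_union_of_disjoint hc.disjoint_primeFactors, pow_add,
      ih hd' (fun q hq h => hW q hq (h.mul_left p)) (fun q hq h => ha q hq (h.mul_left p)),
      rootCount_prime a hp (hW p hp (Dvd.intro _ rfl)) (ha p hp (Dvd.intro _ rfl)),
      hp.primeFactors, card_singleton, pow_one]

/-- Counting `m < M` with a property that is periodic modulo `d`. -/
theorem abs_count_sub_le_of_periodic {d : ℕ} (hd : 0 < d) (p : ℕ → Prop) [DecidablePred p]
    (hp : ∀ m, p (m + d) ↔ p m) (M : ℕ) :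
    |(Nat.count p M : ℝ) - Nat.count p d / d * M| ≤ Nat.count p d := by
  have hp' : ∀ k m, p (k * d + m) ↔ p m := by
    intro k m
    induction k with
    | zero => simp
    | succ k ih => rw [← ih, ← hp (k * d + m)]; ring_nf
  have hmul : ∀ k, Nat.count p (k * d) = k * Nat.count p d := by
    intro k
    induction k with
    | zero => simp
    | succ k ih =>
      rw [add_mul, one_mul, Nat.count_add, ih]
      simp only [hp']
      ring
  set c := Nat.count p d
  have h1 : M / d * c ≤ Nat.count p M := by
    rw [← hmul]; exact Nat.count_monotone p (Nat.div_mul_le_self M d)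
  have h2 : Nat.count p M ≤ (M / d + 1) * c := by
    rw [← hmul]
    refine Nat.count_monotone p ?_
    have := Nat.lt_div_mul_add (a := M) hd
    rw [add_mul, one_mul]; omega
  have h1' : ((M / d : ℕ) : ℝ) * c ≤ Nat.count p M := by exact_mod_cast h1
  have h2' : (Nat.count p M : ℝ) ≤ ((M / d : ℕ) + 1) * c := by exact_mod_cast h2
  have h3 : ((M / d : ℕ) : ℝ) ≤ M / d := Nat.cast_div_le
  have h4 : (M : ℝ) / d ≤ (M / d : ℕ) + 1 := by
    rw [div_le_iff₀ (by exact_mod_cast hd)]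
    have := Nat.lt_div_mul_add (a := M) hd
    have : M ≤ (M / d + 1) * d := by rw [add_mul, one_mul]; omega
    exact_mod_cast this
  have hc : (0 : ℝ) ≤ c := Nat.cast_nonneg _
  have h5 : (c : ℝ) / d * M = M / d * c := by ring
  rw [abs_le, h5]
  constructor <;> nlinarith

theorem prime_of_dvd_prod {S : Finset ℕ} (hS : ∀ p ∈ S, p.Prime) {p : ℕ} (hp : p.Prime)
    (h : p ∣ ∏ q ∈ S, q) : p ∈ S := by
  obtain ⟨q, hq, hpq⟩ := (Prime.dvd_finsetProd_iff hp.prime _).1 h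
  rwa [(Nat.prime_dvd_prime_iff_eq hp (hS q hq)).1 hpq]

/-- The sieve problem for the values of a product of `r` linear forms at `m < M`, with sieving
primes in `S`. The weight of an integer is the number of times it is attained. -/
noncomputable def linSieve {r : ℕ} (hr : 0 < r) (a : Fin r → ℕ) (W : ℕ) (S : Finset ℕ)
    (hS : ∀ p ∈ S, p.Prime ∧ r < p) (M : ℕ) : BoundingSieve where
  support := (range M).image (linProd a W)
  prodPrimes := ∏ p ∈ S, p
  prodPrimes_squarefree := by
    refine Finset.squarefree_prod_of_pairwise_isCoprime ?_ fun p hp =>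
      (Nat.prime_iff.1 (hS p hp).1).squarefree
    intro p hp q hq hpq
    exact Nat.coprime_iff_isRelPrime.1 ((Nat.coprime_primes (hS p hp).1 (hS q hq).1).2 hpq)
  weights n := #{m ∈ range M | linProd a W m = n}
  weights_nonneg n := Nat.cast_nonneg _
  totalMass := M
  nu := recip ^ r
  nu_mult := isMultiplicative_recip_pow r
  nu_pos_of_prime p hp _ := by
    rw [recip_pow_prime r hp]
    have := hp.pos
    positivity
  nu_lt_one_of_prime p hp hd := by
    have hq := prime_of_dvd_prod (fun q hq => (hS q hq).1) hp hd
    rw [recip_pow_prime r hp, div_lt_one (by exact_mod_cast hp.pos)]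
    exact_mod_cast (hS p hq).2

section

variable {r : ℕ} (hr : 0 < r) (a : Fin r → ℕ) (W : ℕ) (S : Finset ℕ)
  (hS : ∀ p ∈ S, p.Prime ∧ r < p) (M : ℕ)

theorem linSieve_sum_support (P : ℕ → Prop) [DecidablePred P] :
    (∑ n ∈ (linSieve hr a W S hS M).support,
      if P n then (linSieve hr a W S hS M).weights n else 0) =
      #{m ∈ range M | P (linProd a W m)} := by
  rw [Finset.card_eq_sum_card_fiberwise (f := linProd a W) (t := (range M).image (linProd a W))
    (fun m hm => mem_coe.2 (mem_image_of_mem _ (mem_filter.1 hm).1))]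
  push_cast
  refine Finset.sum_congr rfl fun n _ => ?_
  change (if P n then ((#{m ∈ range M | linProd a W m = n} : ℕ) : ℝ) else 0) = _
  split_ifs with h
  · congr 2
    ext m
    simp only [mem_filter]
    constructor
    · rintro ⟨h1, rfl⟩; exact ⟨⟨h1, h⟩, rfl⟩
    · rintro ⟨⟨h1, -⟩, h2⟩; exact ⟨h1, h2⟩
  · symm
    rw [Nat.cast_eq_zero, Finset.card_eq_zero, Finset.filter_eq_empty_iff]
    intro m hm heq
    exact h (heq ▸ (mem_filter.1 hm).2)

theorem abs_rem_linSieve_le (hW : ∀ p ∈ S, ¬ p ∣ W)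
    (ha : ∀ p ∈ S, ∀ i j, i ≠ j → ¬ a i ≡ a j [MOD p]) {d : ℕ} (hd : d ∣ ∏ p ∈ S, p) :
    |(linSieve hr a W S hS M).rem d| ≤ (r : ℝ) ^ #d.primeFactors := by
  have hsq : Squarefree d :=
    Squarefree.squarefree_of_dvd hd (linSieve hr a W S hS M).prodPrimes_squarefree
  have hmem : ∀ p, p.Prime → p ∣ d → p ∈ S := fun p hp hpd =>
    prime_of_dvd_prod (fun q hq => (hS q hq).1) hp (hpd.trans hd)
  have hroot := rootCount_of_squarefree a hsq (fun p hp h => hW p (hmem p hp h))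
    (fun p hp h => ha p (hmem p hp h))
  have hper := abs_count_sub_le_of_periodic (Nat.pos_of_ne_zero hsq.ne_zero)
    (fun m => d ∣ linProd a W m)
    (fun m => dvd_linProd_iff_of_modEq a W (by simp [Nat.ModEq])) M
  rw [Nat.count_eq_card_filter_range, Nat.count_eq_card_filter_range, ← rootCount, hroot] at hper
  rw [BoundingSieve.rem, BoundingSieve.multSum, linSieve_sum_support]
  change |_ - (recip ^ r) d * (M : ℝ)| ≤ _
  rw [recip_pow_of_squarefree r hsq]
  exact_mod_cast hper

theorem selbergTerms_linSieve {U : Finset ℕ} (hU : U ⊆ S) :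
    (linSieve hr a W S hS M).selbergTerms (∏ p ∈ U, p) = ∏ p ∈ U, ((r : ℝ) / (p - r)) := by
  rw [BoundingSieve.selbergTerms_isMultiplicative.map_prod_of_prime _
    fun p hp => (hS p (hU hp)).1]
  refine Finset.prod_congr rfl fun p hp => ?_
  obtain ⟨hp', hrp⟩ := hS p (hU hp)
  have h1 : (linSieve hr a W S hS M).nu p = r / p := recip_pow_prime r hp'
  have hp0 : (p : ℝ) ≠ 0 := by exact_mod_cast hp'.ne_zero
  have : (p : ℝ) - r ≠ 0 := by
    have : (r : ℝ) < p := by exact_mod_cast hrp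
    linarith
  rw [BoundingSieve.selbergTerms_apply, hp'.primeFactors, prod_singleton, h1]
  field_simp

theorem primeSetSum_le_selbergSum (R : ℕ) :
    primeSetSum r S R ≤ (linSieve hr a W S hS M).selbergSum R := by
  have hinj : Set.InjOn (fun U : Finset ℕ => ∏ p ∈ U, p)
      (S.powerset.filter (fun U => ∏ p ∈ U, p ≤ R)) := by
    intro U hU V hV h
    simp only [coe_filter, mem_powerset, Set.mem_ofPred_eq] at hU hV
    have h1 := Nat.primeFactors_prod (s := U) fun p hp => (hS p (hU.1 hp)).1
    have h2 := Nat.primeFactors_prod (s := V) fun p hp => (hS p (hV.1 hp)).1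
    rw [← h1, ← h2]
    exact congrArg _ h
  calc primeSetSum r S R = ∑ U ∈ S.powerset with ∏ p ∈ U, p ≤ R,
        (linSieve hr a W S hS M).selbergTerms (∏ p ∈ U, p) := by
        refine Finset.sum_congr rfl fun U hU => ?_
        rw [selbergTerms_linSieve hr a W S hS M (mem_powerset.1 (mem_filter.1 hU).1)]
    _ = ∑ l ∈ (S.powerset.filter (fun U => ∏ p ∈ U, p ≤ R)).image (fun U => ∏ p ∈ U, p),
        (linSieve hr a W S hS M).selbergTerms l := by rw [Finset.sum_image hinj]
    _ ≤ _ := by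
        refine Finset.sum_le_sum_of_subset_of_nonneg ?_ fun l hl _ =>
          (BoundingSieve.selbergTerms_pos (Nat.dvd_of_mem_divisors (mem_filter.1 hl).1)).le
        intro l hl
        obtain ⟨U, hU, rfl⟩ := mem_image.1 hl
        rw [mem_filter, mem_powerset] at hU
        rw [mem_filter, Nat.mem_divisors]
        exact ⟨⟨Finset.prod_dvd_prod_of_subset _ _ _ hU.1, BoundingSieve.prodPrimes_ne_zero⟩, hU.2⟩

theorem sum_pow_card_primeFactors_le {P R : ℕ} (hP : Squarefree P) (hR : 1 ≤ R) (r : ℕ) :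
    ∑ d ∈ P.divisors with d ≤ R, (r : ℝ) ^ #d.primeFactors ≤ R * (1 + Real.log R) ^ r := by
  calc _ ≤ ∑ d ∈ P.divisors with d ≤ R, R * (recip ^ r) d := by
        refine Finset.sum_le_sum fun d hd => ?_
        rw [mem_filter, Nat.mem_divisors] at hd
        have hsq := hP.squarefree_of_dvd hd.1.1
        have hd0 : (0 : ℝ) < d := by exact_mod_cast Nat.pos_of_ne_zero hsq.ne_zero
        have hdR : (d : ℝ) ≤ R := by exact_mod_cast hd.2
        rw [recip_pow_of_squarefree r hsq, mul_div_assoc', le_div_iff₀ hd0, mul_comm]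
        gcongr
    _ ≤ ∑ d ∈ Ioc 0 R, R * (recip ^ r) d := by
        refine Finset.sum_le_sum_of_subset_of_nonneg ?_ fun d _ _ =>
          mul_nonneg (Nat.cast_nonneg _) (recip_pow_nonneg r d)
        intro d hd
        rw [mem_filter] at hd
        rw [mem_Ioc]
        exact ⟨Nat.pos_of_mem_divisors hd.1, hd.2⟩
    _ = R * divSum r R := by rw [← Finset.mul_sum, divSum]
    _ ≤ _ := by
        have := divSum_le r hR
        gcongr

/-- The Selberg bound for the number of `m < M` at which none of `r` linear forms with common
leading coefficient `W` is divisible by a prime of `S`. -/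
theorem card_linSieve_le {r : ℕ} (hr : 0 < r) (a : Fin r → ℕ) (W : ℕ) (S : Finset ℕ)
    (hS : ∀ p ∈ S, p.Prime ∧ r < p) (M : ℕ) (hW : ∀ p ∈ S, ¬ p ∣ W)
    (ha : ∀ p ∈ S, ∀ i j, i ≠ j → ¬ a i ≡ a j [MOD p]) {R : ℕ} (hR : 1 ≤ R) :
    (#{m ∈ range M | ∀ i, ∀ p ∈ S, ¬ p ∣ a i + W * m} : ℝ) ≤
      M * (primeSetSum r S R)⁻¹ + (R * (1 + Real.log R) ^ r) ^ 2 := by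
  set s := linSieve hr a W S hS M with hs
  have hmain := BoundingSieve.siftedSum_le_selberg (s := s) hR
  have hsift : s.siftedSum = (#{m ∈ range M | ∀ i, ∀ p ∈ S, ¬ p ∣ a i + W * m} : ℝ) := by
    rw [BoundingSieve.siftedSum, hs, linSieve_sum_support]
    congr 2
    ext m
    simp only [mem_filter, and_congr_right_iff]
    intro _
    change Nat.Coprime (∏ p ∈ S, p) (linProd a W m) ↔ _
    rw [linProd, Nat.coprime_prod_left_iff]
    simp only [Nat.coprime_prod_right_iff, mem_univ, true_imp_iff]
    constructor
    · intro h i p hp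
      exact (Nat.Prime.coprime_iff_not_dvd (hS p hp).1).1 (h p hp i)
    · intro h p hp i
      exact (Nat.Prime.coprime_iff_not_dvd (hS p hp).1).2 (h i p hp)
  have hG : 0 < primeSetSum r S R := by
    refine Finset.sum_pos (fun U hU => Finset.prod_pos fun p hp => ?_) ⟨∅, ?_⟩
    · obtain ⟨hp', hrp⟩ := hS p (mem_powerset.1 (mem_filter.1 hU).1 hp)
      have h1 : (r : ℝ) < p := by exact_mod_cast hrp
      have h2 : (0 : ℝ) < r := by exact_mod_cast hr
      exact div_pos h2 (by linarith)
    · simp [hR]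
  have hr1 : (1 : ℝ) ≤ r := by exact_mod_cast hr
  have herr : ∑ d₁ ∈ s.prodPrimes.divisors with d₁ ≤ R, ∑ d₂ ∈ s.prodPrimes.divisors with d₂ ≤ R,
      |s.rem (d₁.lcm d₂)| ≤ (R * (1 + Real.log R) ^ r) ^ 2 := by
    calc _ ≤ ∑ d₁ ∈ s.prodPrimes.divisors with d₁ ≤ R, ∑ d₂ ∈ s.prodPrimes.divisors with d₂ ≤ R,
          (r : ℝ) ^ #d₁.primeFactors * (r : ℝ) ^ #d₂.primeFactors := by
          refine Finset.sum_le_sum fun d hd => Finset.sum_le_sum fun e he => ?_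
          rw [mem_filter, Nat.mem_divisors] at hd he
          refine (abs_rem_linSieve_le hr a W S hS M hW ha (Nat.lcm_dvd hd.1.1 he.1.1)).trans ?_
          rw [← pow_add]
          refine pow_le_pow_right₀ hr1 ?_
          refine (card_le_card ?_).trans (card_union_le _ _)
          have hd0 := ne_zero_of_dvd_ne_zero hd.1.2 hd.1.1
          have he0 := ne_zero_of_dvd_ne_zero he.1.2 he.1.1
          rw [← Nat.primeFactors_mul hd0 he0]
          exact Nat.primeFactors_mono (Nat.lcm_dvd_mul d e) (mul_ne_zero hd0 he0)
      _ = (∑ d ∈ s.prodPrimes.divisors with d ≤ R, (r : ℝ) ^ #d.primeFactors) ^ 2 := by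
          rw [sq, Finset.sum_mul_sum]
      _ ≤ _ := by
          have := sum_pow_card_primeFactors_le s.prodPrimes_squarefree hR r
          gcongr
  rw [← hsift]
  refine hmain.trans (add_le_add ?_ herr)
  change (M : ℝ) * _ ≤ _
  have := primeSetSum_le_selbergSum hr a W S hS M R
  gcongr

end

end PrimeMoments

/-! ### The average over tuples of the primes dividing their differences -/

namespace PrimeMoments

open Finset

theorem one_le_prod_real {s : Finset ℕ} {f : ℕ → ℝ} (h : ∀ p ∈ s, 1 ≤ f p) :
    1 ≤ ∏ p ∈ s, f p :=
  Finset.prod_induction f (1 ≤ ·) (fun _ _ => one_le_mul_of_one_le_of_one_le) le_rfl h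

theorem one_le_inv_one_sub_inv {p : ℕ} (hp : p.Prime) : 1 ≤ (1 - (p : ℝ)⁻¹)⁻¹ := by
  have hp1 : (p : ℝ)⁻¹ < 1 := inv_lt_one_of_one_lt₀ (by exact_mod_cast hp.one_lt)
  have hp0 : 0 ≤ (p : ℝ)⁻¹ := by positivity
  exact (one_le_inv₀ (by linarith)).2 (by linarith)

theorem inv_one_sub_inv_le {p : ℕ} (hp : p.Prime) : (1 - (p : ℝ)⁻¹)⁻¹ ≤ 1 + 2 / p := by
  have h2 : (2 : ℝ) ≤ p := by exact_mod_cast hp.two_le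
  have h0 : (0 : ℝ) < p := by linarith
  have h1 : (0 : ℝ) < p - 1 := by linarith
  have : (1 - (p : ℝ)⁻¹)⁻¹ = p / (p - 1) := by field_simp
  rw [this, one_add_div h0.ne', div_le_div_iff₀ h1 h0]
  nlinarith

theorem one_add_pow_le {u : ℝ} (h0 : 0 ≤ u) (h1 : u ≤ 1) (K : ℕ) :
    (1 + u) ^ K ≤ 1 + 3 ^ K * u := by
  induction K with
  | zero => simp [h0]
  | succ K ih =>
    have h3 : (1 : ℝ) ≤ 3 ^ K := one_le_pow₀ (by norm_num)
    calc (1 + u) ^ (K + 1) = (1 + u) ^ K * (1 + u) := pow_succ _ _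
      _ ≤ (1 + 3 ^ K * u) * (1 + u) := by gcongr
      _ ≤ 1 + 3 ^ (K + 1) * u := by
          rw [pow_succ]
          nlinarith [mul_nonneg h0 (sub_nonneg.2 h1), mul_nonneg (sub_nonneg.2 h3) h0,
            mul_nonneg (mul_nonneg (zero_le_one.trans h3) h0) (sub_nonneg.2 h1)]

/-- The prime factors of `d` that exceed `w`. -/
def bigPrimes (w d : ℕ) : Finset ℕ := {p ∈ d.primeFactors | w < p}

theorem mem_bigPrimes {w d p : ℕ} : p ∈ bigPrimes w d ↔ (p.Prime ∧ p ∣ d ∧ d ≠ 0) ∧ w < p := by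
  rw [bigPrimes, mem_filter, Nat.mem_primeFactors]

/-- The product of `(1 - 1/p)^{-K}` over the prime factors `p > w` of `d`. -/
noncomputable def bigFactor (K w d : ℕ) : ℝ := ∏ p ∈ bigPrimes w d, (1 - (p : ℝ)⁻¹)⁻¹ ^ K

theorem one_le_bigFactor (K w d : ℕ) : 1 ≤ bigFactor K w d :=
  one_le_prod_real fun _ hp => one_le_pow₀ (one_le_inv_one_sub_inv (mem_bigPrimes.1 hp).1.1)

theorem bigFactor_zero (K w : ℕ) : bigFactor K w 0 = 1 := by
  simp [bigFactor, bigPrimes]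

/-- On average over `d`, the primes `p > w` dividing `d` have a negligible influence. -/
theorem sum_bigFactor_le (K : ℕ) {w : ℕ} (hw : 0 < w) (H : ℕ) :
    ∑ d ∈ Ioc 0 H, bigFactor K w d ≤ H * Real.exp (2 * 3 ^ K / w) := by
  set C : ℝ := 2 * 3 ^ K with hC
  have hC0 : 0 < C := by positivity
  set T := (Ioc w H).filter Nat.Prime with hT
  have hbig : ∀ d ∈ Ioc 0 H, bigPrimes w d ⊆ T := by
    intro d hd p hp
    rw [mem_Ioc] at hd
    obtain ⟨⟨h1, h2, h3⟩, h4⟩ := mem_bigPrimes.1 hp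
    rw [hT, mem_filter, mem_Ioc]
    exact ⟨⟨h4, (Nat.le_of_dvd hd.1 h2).trans hd.2⟩, h1⟩
  have hTp : ∀ p ∈ T, p.Prime := fun p hp => (mem_filter.1 hp).2
  calc ∑ d ∈ Ioc 0 H, bigFactor K w d
      ≤ ∑ d ∈ Ioc 0 H, ∏ p ∈ bigPrimes w d, (1 + C / p) := by
        refine Finset.sum_le_sum fun d _ => Finset.prod_le_prod (fun p hp => ?_) fun p hp => ?_
        · have := one_le_inv_one_sub_inv (mem_bigPrimes.1 hp).1.1
          positivity
        · have hp' := (mem_bigPrimes.1 hp).1.1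
          have h2 : (2 : ℝ) ≤ p := by exact_mod_cast hp'.two_le
          have h0 := one_le_inv_one_sub_inv hp'
          calc (1 - (p : ℝ)⁻¹)⁻¹ ^ K ≤ (1 + 2 / p) ^ K :=
                pow_le_pow_left₀ (by linarith) (inv_one_sub_inv_le hp') K
            _ ≤ 1 + 3 ^ K * (2 / p) :=
                one_add_pow_le (by positivity) ((div_le_one (by linarith)).2 h2) K
            _ = _ := by rw [hC]; ring
    _ = ∑ d ∈ Ioc 0 H, ∑ U ∈ (bigPrimes w d).powerset, ∏ p ∈ U, (C / p) := by
        simp only [Finset.prod_one_add]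
    _ ≤ ∑ d ∈ Ioc 0 H, ∑ U ∈ T.powerset, if ∏ p ∈ U, p ∣ d then ∏ p ∈ U, (C / p) else 0 := by
        refine Finset.sum_le_sum fun d hd => ?_
        have hnn : ∀ U : Finset ℕ, 0 ≤ ∏ p ∈ U, (C / p) := fun U =>
          Finset.prod_nonneg fun p _ => by positivity
        calc ∑ U ∈ (bigPrimes w d).powerset, ∏ p ∈ U, (C / p)
            = ∑ U ∈ (bigPrimes w d).powerset,
                if ∏ p ∈ U, p ∣ d then ∏ p ∈ U, (C / p) else 0 := by
              refine Finset.sum_congr rfl fun U hU => ?_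
              rw [if_pos]
              have hsub := mem_powerset.1 hU
              refine (Finset.prod_dvd_prod_of_subset U d.primeFactors id fun p hp =>
                (mem_filter.1 (hsub hp)).1).trans (Nat.prod_primeFactors_dvd d)
          _ ≤ _ := by
              refine Finset.sum_le_sum_of_subset_of_nonneg
                (Finset.powerset_mono.2 (hbig d hd)) fun U _ _ => ?_
              split_ifs
              · exact hnn U
              · exact le_rfl
    _ = ∑ U ∈ T.powerset, (∏ p ∈ U, (C / p)) * ((H / ∏ p ∈ U, p : ℕ) : ℝ) := by
        rw [Finset.sum_comm]
        refine Finset.sum_congr rfl fun U _ => ?_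
        rw [← Finset.sum_filter, Finset.sum_const, Nat.Ioc_filter_dvd_card_eq_div, nsmul_eq_mul,
          mul_comm]
    _ ≤ ∑ U ∈ T.powerset, (∏ p ∈ U, (C / p)) * (H / ∏ p ∈ U, (p : ℝ)) := by
        refine Finset.sum_le_sum fun U _ => mul_le_mul_of_nonneg_left ?_
          (Finset.prod_nonneg fun p _ => by positivity)
        refine Nat.cast_div_le.trans (le_of_eq ?_)
        push_cast
        rfl
    _ = H * ∏ p ∈ T, (1 + C / (p : ℝ) ^ 2) := by
        rw [Finset.prod_one_add, Finset.mul_sum]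
        refine Finset.sum_congr rfl fun U _ => ?_
        rw [mul_div_assoc', mul_comm _ (H : ℝ), mul_div_assoc, ← Finset.prod_div_distrib]
        congr 1
        exact Finset.prod_congr rfl fun p _ => by rw [div_div, sq]
    _ ≤ H * ∏ p ∈ T, Real.exp (C / (p : ℝ) ^ 2) := by
        gcongr with p hp
        rw [add_comm]
        exact Real.add_one_le_exp _
    _ = H * Real.exp (∑ p ∈ T, C / (p : ℝ) ^ 2) := by rw [Real.exp_sum]
    _ ≤ H * Real.exp (C / w) := by
        gcongr
        calc ∑ p ∈ T, C / (p : ℝ) ^ 2 ≤ ∑ p ∈ Ioc w H, C / (p : ℝ) ^ 2 :=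
              Finset.sum_le_sum_of_subset_of_nonneg (filter_subset _ _) fun p _ _ => by positivity
          _ = C * ∑ p ∈ Ioc w H, ((p : ℝ) ^ 2)⁻¹ := by
              rw [Finset.mul_sum]; rfl
          _ ≤ C * (w : ℝ)⁻¹ := by
              refine mul_le_mul_of_nonneg_left ?_ hC0.le
              rcases le_or_gt w H with h | h
              · have := sum_Ioc_inv_sq_le_sub (α := ℝ) hw.ne' h
                have h0 : (0 : ℝ) ≤ (H : ℝ)⁻¹ := by positivity
                linarith
              · rw [Ioc_eq_empty (by omega)]
                simp
          _ = C / w := by rw [div_eq_mul_inv]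

/-- For fixed `a`, each positive distance from `a` is attained by at most two integers. -/
theorem sum_dist_le {f : ℕ → ℝ} (hf : ∀ d, 0 ≤ f d) (h0 : f 0 = 0) {a H : ℕ} (ha : a ≤ H) :
    ∑ b ∈ Ioc 0 H, f (Nat.dist a b) ≤ 2 * ∑ d ∈ Ioc 0 H, f d := by
  have hsub : Ioc 0 H ⊆ Ioo 0 a ∪ ({a} ∪ Ioc a H) := by
    intro b hb
    simp only [mem_union, mem_Ioo, mem_Ioc, mem_singleton] at hb ⊢
    omega
  have h1 : ∑ b ∈ Ioo 0 a, f (Nat.dist a b) ≤ ∑ d ∈ Ioc 0 H, f d := by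
    rw [← Finset.sum_image (f := f) (g := fun b => Nat.dist a b)]
    · refine Finset.sum_le_sum_of_subset_of_nonneg ?_ fun d _ _ => hf d
      intro d hd
      obtain ⟨b, hb, rfl⟩ := mem_image.1 hd
      simp only [mem_Ioo, mem_Ioc, Nat.dist] at hb ⊢
      omega
    · intro b hb c hc h
      simp only [coe_Ioo, Set.mem_Ioo, Nat.dist] at hb hc h
      omega
  have h2 : ∑ b ∈ Ioc a H, f (Nat.dist a b) ≤ ∑ d ∈ Ioc 0 H, f d := by
    rw [← Finset.sum_image (f := f) (g := fun b => Nat.dist a b)]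
    · refine Finset.sum_le_sum_of_subset_of_nonneg ?_ fun d _ _ => hf d
      intro d hd
      obtain ⟨b, hb, rfl⟩ := mem_image.1 hd
      simp only [mem_Ioc, Nat.dist] at hb ⊢
      omega
    · intro b hb c hc h
      simp only [coe_Ioc, Set.mem_Ioc, Nat.dist] at hb hc h
      omega
  have hnn : ∀ b, 0 ≤ f (Nat.dist a b) := fun b => hf _
  have hu1 := Finset.sum_union_inter (s₁ := Ioo 0 a) (s₂ := {a} ∪ Ioc a H)
    (f := fun b => f (Nat.dist a b))
  have hu2 := Finset.sum_union_inter (s₁ := {a}) (s₂ := Ioc a H)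
    (f := fun b => f (Nat.dist a b))
  have hi1 : 0 ≤ ∑ b ∈ Ioo 0 a ∩ ({a} ∪ Ioc a H), f (Nat.dist a b) :=
    Finset.sum_nonneg fun b _ => hnn b
  have hi2 : 0 ≤ ∑ b ∈ {a} ∩ Ioc a H, f (Nat.dist a b) := Finset.sum_nonneg fun b _ => hnn b
  have ha0 : ∑ b ∈ {a}, f (Nat.dist a b) = 0 := by rw [sum_singleton, Nat.dist_self, h0]
  have := Finset.sum_le_sum_of_subset_of_nonneg hsub (f := fun b => f (Nat.dist a b))
    fun b _ _ => hnn b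
  linarith

/-- The tuples of length `r` with entries in `{1, …, H}`. -/
def tuples (r H : ℕ) : Finset (Fin r → ℕ) := Fintype.piFinset fun _ => Ioc 0 H

theorem card_tuples (r H : ℕ) : #(tuples r H) = H ^ r := by
  simp [tuples]

theorem sum_tuples_two_coordinates {r : ℕ} (H : ℕ) {i j : Fin r} (hij : i ≠ j)
    (f : ℕ → ℕ → ℝ) :
    ∑ h ∈ tuples r H, f (h i) (h j) =
      (H : ℝ) ^ (r - 2) * ∑ a ∈ Ioc 0 H, ∑ b ∈ Ioc 0 H, f a b := by
  have hmaps : ∀ h ∈ tuples r H, (h i, h j) ∈ Ioc 0 H ×ˢ Ioc 0 H := by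
    intro h hh
    rw [tuples, Fintype.mem_piFinset] at hh
    exact mem_product.2 ⟨hh i, hh j⟩
  rw [← Finset.sum_fiberwise_of_maps_to hmaps, ← Finset.sum_product', Finset.mul_sum]
  refine Finset.sum_congr rfl fun x hx => ?_
  rw [mem_product] at hx
  have hfib : (tuples r H).filter (fun h => (h i, h j) = x) =
      Fintype.piFinset fun k => if k = i then {x.1} else if k = j then {x.2} else Ioc 0 H := by
    ext h
    simp only [tuples, mem_filter, Fintype.mem_piFinset]
    constructor
    · rintro ⟨h1, rfl⟩ k
      split_ifs with hi hj
      · simp [hi]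
      · simp [hj]
      · exact h1 k
    · intro h1
      have hi := h1 i
      have hj := h1 j
      simp only [if_true, if_neg hij.symm, mem_singleton] at hi hj
      refine ⟨fun k => ?_, by rw [hi, hj]⟩
      have hk := h1 k
      split_ifs at hk with h2 h3
      · rw [mem_singleton] at hk; rw [hk]; exact hx.1
      · rw [mem_singleton] at hk; rw [hk]; exact hx.2
      · exact hk
  have hcard : #((tuples r H).filter (fun h => (h i, h j) = x)) = H ^ (r - 2) := by
    rw [hfib, Fintype.card_piFinset]
    have : ∀ k, #(if k = i then {x.1} else if k = j then {x.2} else Ioc 0 H) =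
        if k ∈ (univ.erase i).erase j then H else 1 := by
      intro k
      by_cases hi : k = i
      · simp [hi]
      · by_cases hj : k = j
        · subst hj; simp [hi]
        · simp [hi, hj]
    simp only [this]
    rw [Finset.prod_ite_mem, univ_inter, Finset.prod_const, card_erase_of_mem
      (mem_erase.2 ⟨hij.symm, mem_univ _⟩), card_erase_of_mem (mem_univ _), card_univ,
      Fintype.card_fin]
    rfl
  rw [Finset.sum_congr rfl (g := fun _ => f x.1 x.2), Finset.sum_const, hcard, nsmul_eq_mul]
  · push_cast; rfl
  · rintro h hh
    rw [← (mem_filter.1 hh).2]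

/-- The primes exceeding `w` that divide a difference of two distinct entries of a tuple. -/
def diffPrimes {r : ℕ} (w : ℕ) (h : Fin r → ℕ) : Finset ℕ :=
  univ.biUnion fun x : Fin r × Fin r => bigPrimes w (Nat.dist (h x.1) (h x.2))

theorem prime_of_mem_diffPrimes {r w p : ℕ} {h : Fin r → ℕ} (hp : p ∈ diffPrimes w h) :
    p.Prime := by
  obtain ⟨x, -, hx⟩ := mem_biUnion.1 hp
  exact (mem_bigPrimes.1 hx).1.1

/-- The factor `∏ (1 - 1/p)^{-r}` lost in the sieve by not sieving with the primes `p > w` that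
divide a difference of two entries of the tuple. -/
noncomputable def diffFactor {r : ℕ} (w : ℕ) (h : Fin r → ℕ) : ℝ :=
  ∏ p ∈ diffPrimes w h, (1 - (p : ℝ)⁻¹)⁻¹ ^ r

theorem one_le_diffFactor {r : ℕ} (w : ℕ) (h : Fin r → ℕ) : 1 ≤ diffFactor w h :=
  one_le_prod_real fun _ hp => one_le_pow₀ (one_le_inv_one_sub_inv (prime_of_mem_diffPrimes hp))

theorem prod_biUnion_le_prod_prod {ι : Type*} (s : Finset ι) (t : ι → Finset ℕ) {f : ℕ → ℝ}
    (hf : ∀ i ∈ s, ∀ p ∈ t i, 1 ≤ f p) :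
    ∏ p ∈ s.biUnion t, f p ≤ ∏ i ∈ s, ∏ p ∈ t i, f p := by
  classical
  induction s using Finset.induction_on with
  | empty => simp
  | insert i s hi ih =>
    have ih' := ih fun j hj => hf j (mem_insert_of_mem hj)
    have hu : ∀ p ∈ s.biUnion t, 1 ≤ f p := fun p hp => by
      obtain ⟨j, hj, hpj⟩ := mem_biUnion.1 hp
      exact hf j (mem_insert_of_mem hj) p hpj
    rw [biUnion_insert, Finset.prod_insert hi]
    have hun : ∏ p ∈ t i ∪ s.biUnion t, f p ≤ (∏ p ∈ t i, f p) * ∏ p ∈ s.biUnion t, f p := by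
      rw [← Finset.prod_union_inter]
      refine le_mul_of_one_le_right ?_ ?_
      · refine Finset.prod_nonneg fun p hp => ?_
        rcases mem_union.1 hp with h | h
        · linarith [hf i (mem_insert_self _ _) p h]
        · linarith [hu p h]
      · exact one_le_prod_real fun p hp => hu p (mem_inter.1 hp).2
    refine hun.trans (mul_le_mul_of_nonneg_left ih' ?_)
    exact Finset.prod_nonneg fun p hp => by linarith [hf i (mem_insert_self _ _) p hp]

/-- The inequality of arithmetic and geometric means reduces a tuple to its pairs of entries. -/
theorem diffFactor_le {r : ℕ} (hr : 0 < r) (w : ℕ) (h : Fin r → ℕ) :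
    diffFactor w h ≤ ∑ x : Fin r × Fin r,
      ((r * r : ℕ) : ℝ)⁻¹ * bigFactor (r * (r * r)) w (Nat.dist (h x.1) (h x.2)) := by
  set N := r * r with hN
  have hN0 : N ≠ 0 := by positivity
  have hNr : (N : ℝ) ≠ 0 := by exact_mod_cast hN0
  have h1 : diffFactor w h ≤ ∏ x : Fin r × Fin r, bigFactor r w (Nat.dist (h x.1) (h x.2)) :=
    prod_biUnion_le_prod_prod _ _ fun x _ p hp =>
      one_le_pow₀ (one_le_inv_one_sub_inv (mem_bigPrimes.1 hp).1.1)
  -- The pairs with equal entries contribute `bigFactor r w 0 = 1`, so all `r²` pairs may be used.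
  have hpow : ∀ d, bigFactor (r * N) w d = bigFactor r w d ^ N := by
    intro d
    rw [bigFactor, bigFactor, ← Finset.prod_pow]
    exact Finset.prod_congr rfl fun p _ => by rw [pow_mul]
  have hnn : ∀ d, 0 ≤ bigFactor r w d := fun d => zero_le_one.trans (one_le_bigFactor r w d)
  have hamgm := Real.geom_mean_le_arith_mean_weighted (univ : Finset (Fin r × Fin r))
    (fun _ => (N : ℝ)⁻¹) (fun x => bigFactor r w (Nat.dist (h x.1) (h x.2)) ^ N)
    (fun _ _ => by positivity) (by simp [hN, field]) (fun x _ => pow_nonneg (hnn _) _)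
  refine h1.trans (le_trans (le_of_eq ?_) (hamgm.trans (le_of_eq ?_)))
  · exact Finset.prod_congr rfl fun x _ => (Real.pow_rpow_inv_natCast (hnn _) hN0).symm
  · exact Finset.sum_congr rfl fun x _ => by rw [hpow]

/-- For `w` large, `diffFactor w` is close to `1` on average over tuples. -/
theorem sum_diffFactor_sub_one_le {r : ℕ} (hr : 0 < r) {w : ℕ} (hw : 0 < w) (H : ℕ) :
    ∑ h ∈ tuples r H, (diffFactor w h - 1) ≤
      2 * (H : ℝ) ^ r * (Real.exp (2 * 3 ^ (r * (r * r)) / w) - 1) := by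
  set K := r * (r * r) with hK
  set N := r * r with hN
  have hNr : (N : ℝ) ≠ 0 := by
    have : N ≠ 0 := by positivity
    exact_mod_cast this
  set η := Real.exp (2 * 3 ^ K / w) - 1 with hη
  have hη0 : 0 ≤ η := by
    have : (0 : ℝ) ≤ 2 * 3 ^ K / w := by positivity
    rw [hη]; linarith [Real.one_le_exp this]
  have hnn : ∀ d, 0 ≤ bigFactor K w d - 1 := fun d => by linarith [one_le_bigFactor K w d]
  have hd : ∑ d ∈ Ioc 0 H, (bigFactor K w d - 1) ≤ H * η := by
    rw [Finset.sum_sub_distrib, Finset.sum_const, Nat.card_Ioc, nsmul_eq_mul, hη]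
    have := sum_bigFactor_le K hw H
    simp only [Nat.sub_zero, mul_one]
    linarith
  have hpair : ∀ x : Fin r × Fin r,
      ∑ h ∈ tuples r H, (bigFactor K w (Nat.dist (h x.1) (h x.2)) - 1) ≤ 2 * (H : ℝ) ^ r * η := by
    rintro ⟨i, j⟩
    by_cases hij : i = j
    · subst hij
      simp only [Nat.dist_self, bigFactor_zero, sub_self, Finset.sum_const_zero]
      positivity
    · have hr2 : 2 ≤ r := by
        have := i.2; have := j.2
        by_contra hlt
        exact hij (Fin.ext (by omega))
      have := sum_tuples_two_coordinates H hij (fun a b => bigFactor K w (Nat.dist a b) - 1)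
      rw [this]
      calc (H : ℝ) ^ (r - 2) * ∑ a ∈ Ioc 0 H, ∑ b ∈ Ioc 0 H, (bigFactor K w (Nat.dist a b) - 1)
          ≤ (H : ℝ) ^ (r - 2) * ∑ a ∈ Ioc 0 H, 2 * (H * η) := by
            gcongr with a ha
            refine (sum_dist_le (f := fun d => bigFactor K w d - 1) hnn
              (by simp [bigFactor_zero]) (mem_Ioc.1 ha).2).trans ?_
            gcongr
        _ = 2 * (H : ℝ) ^ (r - 2 + 2) * η := by
            rw [Finset.sum_const, Nat.card_Ioc, nsmul_eq_mul, Nat.sub_zero]; ring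
        _ = _ := by rw [Nat.sub_add_cancel hr2]
  calc ∑ h ∈ tuples r H, (diffFactor w h - 1)
      ≤ ∑ h ∈ tuples r H, ∑ x : Fin r × Fin r,
          (N : ℝ)⁻¹ * (bigFactor K w (Nat.dist (h x.1) (h x.2)) - 1) := by
        refine Finset.sum_le_sum fun h _ => ?_
        have h1 := diffFactor_le hr w h
        have h2 : ∑ x : Fin r × Fin r, (N : ℝ)⁻¹ = 1 := by simp [hN, field]
        simp only [mul_sub, mul_one]
        rw [Finset.sum_sub_distrib, h2]
        linarith
    _ = ∑ x : Fin r × Fin r, (N : ℝ)⁻¹ *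
          ∑ h ∈ tuples r H, (bigFactor K w (Nat.dist (h x.1) (h x.2)) - 1) := by
        rw [Finset.sum_comm]; simp only [Finset.mul_sum]
    _ ≤ ∑ x : Fin r × Fin r, (N : ℝ)⁻¹ * (2 * (H : ℝ) ^ r * η) := by
        gcongr with x _
        exact hpair x
    _ = _ := by
        simp only [Finset.sum_const, card_univ, Fintype.card_prod, Fintype.card_fin, nsmul_eq_mul]
        rw [← hN]
        field_simp

/-! ### The density of integers free of small primes -/

open Filter Topology

/-- The product `∏_{p ≤ w} (1 - 1/p)^{-1}`. -/
noncomputable def mertensProd (w : ℕ) : ℝ := ∏ p ∈ Nat.primesLE w, (1 - (p : ℝ)⁻¹)⁻¹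

theorem one_le_mertensProd (w : ℕ) : 1 ≤ mertensProd w :=
  one_le_prod_real fun _ hp => one_le_inv_one_sub_inv (Nat.prime_of_mem_primesLE hp)

theorem tendsto_primeCounting_two_pow :
    Tendsto (fun j : ℕ => (Nat.primeCounting (2 ^ (j + 1)) : ℝ) / 2 ^ j) atTop (𝓝 0) := by
  have hpow : Tendsto (fun j : ℕ => (2 : ℝ) ^ (j + 1)) atTop atTop :=
    (tendsto_pow_atTop_atTop_of_one_lt (by norm_num)).comp (tendsto_add_atTop_nat 1)
  have h1 := hpow.eventually (Chebyshev.eventually_primeCounting_le (ε := 1) one_pos)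
  have h2 : Tendsto (fun j : ℕ => (Real.log 4 + 1) * 2 / Real.log ((2 : ℝ) ^ (j + 1))) atTop
      (𝓝 0) := tendsto_const_nhds.div_atTop (Real.tendsto_log_atTop.comp hpow)
  refine tendsto_of_tendsto_of_tendsto_of_le_of_le' tendsto_const_nhds h2
    (Eventually.of_forall fun j => by positivity) ?_
  filter_upwards [h1] with j hj
  have hfl : ⌊(2 : ℝ) ^ (j + 1)⌋₊ = 2 ^ (j + 1) := by
    have : ((2 : ℝ) ^ (j + 1)) = ((2 ^ (j + 1) : ℕ) : ℝ) := by push_cast; rfl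
    rw [this, Nat.floor_natCast]
  rw [hfl] at hj
  rw [div_le_iff₀ (by positivity)]
  refine hj.trans (le_of_eq ?_)
  rw [pow_succ]
  ring

/-- `∏_{p ≤ w} (1 - 1/p)^{-1}` grows more slowly than any power of `w` along the powers of two:
by Chebyshev's bound, doubling `w` multiplies it by `1 + o(1)`. -/
theorem tendsto_mertensProd_pow_div (r : ℕ) :
    Tendsto (fun j : ℕ => mertensProd (2 ^ j) ^ r / 2 ^ j) atTop (𝓝 0) := by
  have hstep : ∀ j : ℕ, mertensProd (2 ^ (j + 1)) ≤
      mertensProd (2 ^ j) * Real.exp (2 * (Nat.primeCounting (2 ^ (j + 1)) / 2 ^ j)) := by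
    intro j
    have hsub : Nat.primesLE (2 ^ j) ⊆ Nat.primesLE (2 ^ (j + 1)) := fun p hp => by
      rw [Nat.mem_primesLE] at hp ⊢
      exact ⟨hp.1.trans (Nat.pow_le_pow_right (by norm_num) (by omega)), hp.2⟩
    rw [mertensProd, ← Finset.prod_sdiff hsub, mul_comm, ← mertensProd]
    refine mul_le_mul_of_nonneg_left ?_ (zero_le_one.trans (one_le_mertensProd _))
    set D := Nat.primesLE (2 ^ (j + 1)) \ Nat.primesLE (2 ^ j) with hD
    calc ∏ p ∈ D, (1 - (p : ℝ)⁻¹)⁻¹ ≤ ∏ p ∈ D, Real.exp (2 / 2 ^ j) := by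
          refine Finset.prod_le_prod (fun p hp => ?_) fun p hp => ?_
          · have := one_le_inv_one_sub_inv (Nat.prime_of_mem_primesLE (mem_sdiff.1 hp).1)
            linarith
          · obtain ⟨h1, h2⟩ := mem_sdiff.1 hp
            have hp' := Nat.prime_of_mem_primesLE h1
            have hlt : 2 ^ j < p := by
              by_contra hle
              exact h2 (Nat.mem_primesLE.2 ⟨not_lt.1 hle, hp'⟩)
            have hlt' : (2 : ℝ) ^ j ≤ p := by exact_mod_cast hlt.le
            calc (1 - (p : ℝ)⁻¹)⁻¹ ≤ 2 / p + 1 := by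
                  rw [add_comm]; exact inv_one_sub_inv_le hp'
              _ ≤ 2 / 2 ^ j + 1 := by gcongr
              _ ≤ _ := Real.add_one_le_exp _
      _ = Real.exp (#D * (2 / 2 ^ j)) := by rw [Finset.prod_const, ← Real.exp_nat_mul]
      _ ≤ _ := by
          apply Real.exp_le_exp.2
          have : #D ≤ Nat.primeCounting (2 ^ (j + 1)) := by
            refine (card_le_card sdiff_subset).trans (le_of_eq ?_)
            rw [Nat.primesLE_card_eq_primeCounting]
          have : (#D : ℝ) ≤ Nat.primeCounting (2 ^ (j + 1)) := by exact_mod_cast this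
          calc (#D : ℝ) * (2 / 2 ^ j) ≤ Nat.primeCounting (2 ^ (j + 1)) * (2 / 2 ^ j) := by gcongr
            _ = _ := by ring
  have hlim : Tendsto (fun j : ℕ => Real.exp (2 * ((Nat.primeCounting (2 ^ (j + 1)) : ℝ) / 2 ^ j))
      ^ r / 2) atTop (𝓝 (1 / 2)) := by
    have := ((tendsto_primeCounting_two_pow.const_mul 2).rexp.pow r).div_const 2
    simpa using this
  refine (summable_of_ratio_norm_eventually_le (r := 3 / 4) (by norm_num) ?_).tendsto_atTop_zero
  -- Doubling `w` doubles the denominator, so the ratio of consecutive terms tends to `1 / 2`.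
  filter_upwards [hlim.eventually (eventually_le_nhds (by norm_num : (1 / 2 : ℝ) < 3 / 4))]
    with j hj
  have hm := zero_le_one.trans (one_le_mertensProd (2 ^ j))
  have hm' := zero_le_one.trans (one_le_mertensProd (2 ^ (j + 1)))
  rw [Real.norm_of_nonneg (by positivity), Real.norm_of_nonneg (by positivity)]
  calc mertensProd (2 ^ (j + 1)) ^ r / 2 ^ (j + 1)
      ≤ (mertensProd (2 ^ j) * Real.exp (2 * (Nat.primeCounting (2 ^ (j + 1)) / 2 ^ j))) ^ r /
          2 ^ (j + 1) := by
        have := hstep j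
        gcongr
    _ = (Real.exp (2 * ((Nat.primeCounting (2 ^ (j + 1)) : ℝ) / 2 ^ j)) ^ r / 2) *
          (mertensProd (2 ^ j) ^ r / 2 ^ j) := by
        rw [mul_pow, pow_succ _ j]; field_simp; ring
    _ ≤ _ := by gcongr

/-- The parameter `w` can be chosen so that the average of `diffFactor w - 1` is negligible even
relative to the density `∏_{p ≤ w} (1 - 1/p)^r` of good residue classes. -/
theorem exists_mertensProd_pow_mul_le (r : ℕ) {C η : ℝ} (hC : 0 ≤ C) (hη : 0 < η) (w₀ : ℕ) :
    ∃ w, w₀ ≤ w ∧ mertensProd w ^ r * (Real.exp (C / w) - 1) ≤ η := by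
  have h1 := (tendsto_mertensProd_pow_div r).const_mul (2 * C)
  rw [mul_zero] at h1
  have hpow : Tendsto (fun j : ℕ => (2 : ℝ) ^ j) atTop atTop :=
    tendsto_pow_atTop_atTop_of_one_lt (by norm_num)
  have hpow' : Tendsto (fun j : ℕ => 2 ^ j) atTop (atTop : Filter ℕ) :=
    tendsto_pow_atTop_atTop_of_one_lt (by norm_num)
  obtain ⟨j, hj1, hj2, hj3⟩ := ((h1.eventually (eventually_le_nhds hη)).and
    ((hpow.eventually_ge_atTop C).and (hpow'.eventually_ge_atTop w₀))).exists
  refine ⟨2 ^ j, hj3, ?_⟩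
  have hm := zero_le_one.trans (one_le_mertensProd (2 ^ j))
  have hx : |C / 2 ^ j| ≤ 1 := by
    rw [abs_of_nonneg (by positivity), div_le_one (by positivity)]; exact hj2
  have hexp := (le_abs_self _).trans (Real.abs_exp_sub_one_le hx)
  rw [abs_of_nonneg (by positivity : 0 ≤ C / 2 ^ j)] at hexp
  push_cast
  calc mertensProd (2 ^ j) ^ r * (Real.exp (C / 2 ^ j) - 1)
      ≤ mertensProd (2 ^ j) ^ r * (2 * (C / 2 ^ j)) := by gcongr
    _ = 2 * C * (mertensProd (2 ^ j) ^ r / 2 ^ j) := by ring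
    _ ≤ η := hj1

end PrimeMoments

/-! ### Prime tuples and the average of the sieve bound -/

namespace PrimeMoments

open Finset

theorem mertensProd_mul_totient (w : ℕ) :
    mertensProd w * (Nat.totient (primorial w) : ℝ) = primorial w := by
  have h := congrArg (fun q : ℚ => (q : ℝ)) (Nat.totient_eq_mul_prod_factors (primorial w))
  simp only [primeFactors_primorial] at h
  push_cast at h
  rw [h, mertensProd, Finset.prod_inv_distrib, mul_comm, mul_assoc, mul_inv_cancel₀, mul_one]
  refine Finset.prod_ne_zero_iff.2 fun p hp => ?_
  have hp1 : (p : ℝ)⁻¹ < 1 :=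
    inv_lt_one_of_one_lt₀ (by exact_mod_cast (Nat.prime_of_mem_primesLE hp).one_lt)
  linarith

/-- The residue classes modulo `W` whose shifts by the entries of a tuple are all coprime
to `W`. -/
def goodClasses {r : ℕ} (W : ℕ) (h : Fin r → ℕ) : Finset ℕ :=
  {b ∈ range W | ∀ i, W.Coprime (b + h i)}

/-- The primes up to `R` used in the sieve for a tuple: those that exceed `w` and divide no
difference of its entries. -/
def sievePrimes {r : ℕ} (w R : ℕ) (h : Fin r → ℕ) : Finset ℕ :=
  {p ∈ range (R + 1) | p.Prime ∧ w < p ∧ p ∉ diffPrimes w h}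

theorem mem_sievePrimes {r w R p : ℕ} {h : Fin r → ℕ} :
    p ∈ sievePrimes w R h ↔ p ≤ R ∧ p.Prime ∧ w < p ∧ p ∉ diffPrimes w h := by
  rw [sievePrimes, mem_filter, mem_range, Nat.lt_succ_iff]

/-- The sieve bound in a single residue class modulo the primorial of `w`. -/
theorem card_class_le {r : ℕ} (hr : 0 < r) {w : ℕ} (hw : r ≤ w) {h : Fin r → ℕ}
    (hh : Function.Injective h) {R : ℕ} (hR : 1 ≤ R) (b M : ℕ) :
    (#{m ∈ range M | ∀ i, ∀ p ∈ sievePrimes w R h,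
        ¬ p ∣ b + h i + primorial w * m} : ℝ) ≤
      M * (r.factorial * mertensProd w ^ r * diffFactor w h / Real.log (R + 1) ^ r) +
        (R * (1 + Real.log R) ^ r) ^ 2 := by
  set S := sievePrimes w R h
  have hS1 : ∀ p ∈ S, p.Prime ∧ r < p := fun p hp => by
    obtain ⟨-, h2, h3, -⟩ := mem_sievePrimes.1 hp
    exact ⟨h2, by omega⟩
  have hW : ∀ p ∈ S, ¬ p ∣ primorial w := fun p hp hd => by
    obtain ⟨-, h2, h3, -⟩ := mem_sievePrimes.1 hp
    have := h2.dvd_primorial_iff.1 hd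
    omega
  have ha : ∀ p ∈ S, ∀ i j, i ≠ j → ¬ b + h i ≡ b + h j [MOD p] := by
    intro p hp i j hij hmod
    obtain ⟨-, h2, h3, h4⟩ := mem_sievePrimes.1 hp
    have hmod' : h i ≡ h j [MOD p] := Nat.ModEq.add_left_cancel' b hmod
    apply h4
    refine mem_biUnion.2 ⟨(i, j), mem_univ _, mem_bigPrimes.2 ⟨⟨h2, ?_, ?_⟩, h3⟩⟩
    · rcases le_total (h i) (h j) with hle | hle
      · rw [Nat.dist_eq_sub_of_le hle]
        exact (Nat.modEq_iff_dvd' hle).1 hmod'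
      · rw [Nat.dist_eq_sub_of_le_right hle]
        exact (Nat.modEq_iff_dvd' hle).1 hmod'.symm
    · intro h0
      exact hij (hh (Nat.eq_of_dist_eq_zero h0))
  have hmain := card_linSieve_le hr (fun i => b + h i) (primorial w) S hS1 M hW ha hR
  refine hmain.trans (add_le_add (mul_le_mul_of_nonneg_left ?_ (Nat.cast_nonneg _)) le_rfl)
  have hQ := log_pow_le_primeSetSum r hR (Q := Nat.primesLE w ∪ diffPrimes w h) (S := S)
    (fun p hp => by
      rcases mem_union.1 hp with h1 | h1
      · exact Nat.prime_of_mem_primesLE h1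
      · exact prime_of_mem_diffPrimes h1) hS1
    (fun p hp hpR => by
      rw [mem_union, mem_sievePrimes, Nat.mem_primesLE]
      rcases le_or_gt p w with h1 | h1
      · exact Or.inl (Or.inl ⟨h1, hp⟩)
      · by_cases h2 : p ∈ diffPrimes w h
        · exact Or.inl (Or.inr h2)
        · exact Or.inr ⟨hpR, hp, h1, h2⟩)
  -- The unused primes are those up to `w` and those above `w` dividing a difference.
  have hdisj : Disjoint (Nat.primesLE w) (diffPrimes w h) := by
    rw [Finset.disjoint_left]
    intro p hp hp'
    obtain ⟨x, -, hx⟩ := mem_biUnion.1 hp'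
    have := (mem_bigPrimes.1 hx).2
    have := Nat.le_of_mem_primesLE hp
    omega
  rw [Finset.prod_union hdisj, Finset.prod_pow, ← mertensProd, ← diffFactor] at hQ
  have hlog : 0 < Real.log (R + 1) := Real.log_pos (by
    have : (1 : ℝ) ≤ R := by exact_mod_cast hR
    linarith)
  have hfac : (0 : ℝ) < r.factorial := by exact_mod_cast r.factorial_pos
  have hVE : 0 < mertensProd w ^ r * diffFactor w h :=
    mul_pos (pow_pos (lt_of_lt_of_le one_pos (one_le_mertensProd w)) r)
      (lt_of_lt_of_le one_pos (one_le_diffFactor w h))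
  -- Positivity of the Selberg sum is read off from the positive lower bound `hQ`.
  have hG : 0 < primeSetSum r S R := by
    by_contra hneg
    have h1 : 0 < Real.log (R + 1) ^ r / r.factorial := by positivity
    nlinarith [mul_nonneg hVE.le (neg_nonneg.2 (not_lt.1 hneg))]
  rw [inv_le_iff_one_le_mul₀ hG, div_mul_eq_mul_div, one_le_div (by positivity)]
  rw [div_le_iff₀ hfac] at hQ
  linarith

/-- The sieve bound for the number of translates of a tuple that consist of primes. -/
theorem card_prime_translates_le {r : ℕ} (hr : 0 < r) {w : ℕ} (hw : r ≤ w) {h : Fin r → ℕ}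
    (hh : Function.Injective h) {R : ℕ} (hR : 1 ≤ R) (hwR : w ≤ R) (N : ℕ) :
    (#{n ∈ range N | ∀ i, (n + h i).Prime} : ℝ) ≤ (R + 1) +
      #(goodClasses (primorial w) h) * (((N : ℝ) / primorial w + 1) *
        (r.factorial * mertensProd w ^ r * diffFactor w h / Real.log (R + 1) ^ r) +
        (R * (1 + Real.log R) ^ r) ^ 2) := by
  set W := primorial w with hW
  have hW0 : 0 < W := primorial_pos w
  set A := (range N).filter (fun n => R < n ∧ ∀ i, (n + h i).Prime) with hA
  have hsub : (range N).filter (fun n => ∀ i, (n + h i).Prime) ⊆ range (R + 1) ∪ A := by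
    intro n hn
    rw [mem_filter] at hn
    rw [mem_union, mem_range, hA, mem_filter]
    rcases le_or_gt n R with h1 | h1
    · exact Or.inl (by omega)
    · exact Or.inr ⟨hn.1, h1, hn.2⟩
  have hcard : #{n ∈ range N | ∀ i, (n + h i).Prime} ≤ (R + 1) + #A := by
    refine (card_le_card hsub).trans ((card_union_le _ _).trans ?_)
    rw [card_range]
  have hmaps : Set.MapsTo (fun n => n % W) (A : Set ℕ) (goodClasses W h : Set ℕ) := by
    intro n hn
    simp only [hA, coe_filter, mem_range, Set.mem_ofPred_eq] at hn
    simp only [goodClasses, coe_filter, mem_range, Set.mem_ofPred_eq]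
    refine ⟨Nat.mod_lt _ hW0, fun i => ?_⟩
    have hprime := hn.2.2 i
    have hc : W.Coprime (n + h i) := by
      refine Nat.Coprime.symm ((Nat.Prime.coprime_iff_not_dvd hprime).2 fun hd => ?_)
      have := hprime.dvd_primorial_iff.1 hd
      omega
    have hmod : n % W + h i ≡ n + h i [MOD W] := (Nat.mod_modEq n W).add_right _
    rw [Nat.Coprime, Nat.gcd_comm, hmod.gcd_eq, Nat.gcd_comm]
    exact hc
  have hfib : ∀ b ∈ goodClasses W h, (#{n ∈ A | n % W = b} : ℝ) ≤ ((N : ℝ) / W + 1) *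
        (r.factorial * mertensProd w ^ r * diffFactor w h / Real.log (R + 1) ^ r) +
        (R * (1 + Real.log R) ^ r) ^ 2 := by
    intro b _
    have h1 : #{n ∈ A | n % W = b} ≤ #{m ∈ range (N / W + 1) | ∀ i, ∀ p ∈ sievePrimes w R h,
        ¬ p ∣ b + h i + W * m} := by
      refine card_le_card_of_injOn (fun n => n / W) ?_ ?_
      · intro n hn
        simp only [hA, coe_filter, mem_filter, mem_range, Set.mem_ofPred_eq] at hn ⊢
        obtain ⟨⟨hnN, hnR, hnp⟩, rfl⟩ := hn
        refine ⟨Nat.lt_succ_of_le (Nat.div_le_div_right hnN.le), fun i p hp hd => ?_⟩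
        obtain ⟨hpR, hp, -, -⟩ := mem_sievePrimes.1 hp
        have heq : n % W + h i + W * (n / W) = n + h i := by
          have := Nat.mod_add_div n W
          omega
        rw [heq, Nat.prime_dvd_prime_iff_eq hp (hnp i)] at hd
        omega
      · intro n hn n' hn' heq
        simp only [coe_filter, Set.mem_ofPred_eq] at hn hn'
        have h2 := Nat.mod_add_div n W
        have h3 := Nat.mod_add_div n' W
        simp only at heq
        rw [hn.2, heq] at h2
        rw [hn'.2] at h3
        omega
    have hR0 : 0 ≤ Real.log (R + 1) := Real.log_nonneg (by
      have : (0 : ℝ) ≤ R := Nat.cast_nonneg R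
      linarith)
    have hV := zero_le_one.trans (one_le_mertensProd w)
    have hE := zero_le_one.trans (one_le_diffFactor w h)
    have h2 : ((N / W + 1 : ℕ) : ℝ) ≤ (N : ℝ) / W + 1 := by
      push_cast
      have : ((N / W : ℕ) : ℝ) ≤ (N : ℝ) / W := Nat.cast_div_le
      linarith
    calc (#{n ∈ A | n % W = b} : ℝ) ≤ _ := by exact_mod_cast h1
      _ ≤ _ := card_class_le hr hw hh hR b (N / W + 1)
      _ ≤ _ := by gcongr
  -- Only the good residue classes contain prime translates, since the primes exceed `R ≥ w`.
  have hAcard : (#A : ℝ) ≤ #(goodClasses W h) * (((N : ℝ) / W + 1) *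
        (r.factorial * mertensProd w ^ r * diffFactor w h / Real.log (R + 1) ^ r) +
        (R * (1 + Real.log R) ^ r) ^ 2) := by
    rw [Finset.card_eq_sum_card_fiberwise hmaps]
    push_cast
    refine (Finset.sum_le_sum hfib).trans (le_of_eq ?_)
    rw [Finset.sum_const, nsmul_eq_mul]
  have : (#{n ∈ range N | ∀ i, (n + h i).Prime} : ℝ) ≤ (R + 1) + #A := by exact_mod_cast hcard
  linarith

/-- On average over tuples, the proportion of good classes is at most the density predicted by
independence. -/
theorem sum_card_goodClasses_le (r w H : ℕ) :
    mertensProd w ^ r * ∑ h ∈ tuples r H, (#(goodClasses (primorial w) h) : ℝ) ≤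
      primorial w * ((H : ℝ) + primorial w) ^ r := by
  set W := primorial w with hW
  have hW0 : 0 < W := primorial_pos w
  have hWr : (0 : ℝ) < W := by exact_mod_cast hW0
  have hV := zero_le_one.trans (one_le_mertensProd w)
  have h1 : ∑ h ∈ tuples r H, #(goodClasses W h) =
      ∑ b ∈ range W, #((Ioc 0 H).filter fun t => W.Coprime (b + t)) ^ r := by
    simp only [goodClasses, Finset.card_filter]
    rw [Finset.sum_comm]
    refine Finset.sum_congr rfl fun b _ => ?_
    rw [← Finset.card_filter, ← Finset.card_filter]
    have : (tuples r H).filter (fun h => ∀ i, W.Coprime (b + h i)) =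
        Fintype.piFinset fun _ : Fin r => (Ioc 0 H).filter fun t => W.Coprime (b + t) := by
      ext h
      simp only [tuples, mem_filter, Fintype.mem_piFinset]
      exact ⟨fun h i => ⟨h.1 i, h.2 i⟩, fun h => ⟨fun i => (h i).1, fun i => (h i).2⟩⟩
    rw [this, Fintype.card_piFinset]
    simp
  have h2 : ∀ b, mertensProd w * (#((Ioc 0 H).filter fun t => W.Coprime (b + t)) : ℝ) ≤
      (H : ℝ) + W := by
    intro b
    have h3 : #((Ioc 0 H).filter fun t => W.Coprime (b + t)) ≤ W.totient * (H / W + 1) := by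
      refine le_trans ?_ (Nat.Ico_filter_coprime_le (b + 1) H hW0.ne')
      refine card_le_card_of_injOn (fun t => b + t) ?_ fun x _ y _ h => Nat.add_left_cancel h
      intro t ht
      simp only [coe_filter, mem_Ioc, mem_Ico, Set.mem_ofPred_eq] at ht ⊢
      exact ⟨by omega, ht.2⟩
    have h4 : (#((Ioc 0 H).filter fun t => W.Coprime (b + t)) : ℝ) ≤
        W.totient * (H / W + 1) := by
      have h5 : (#((Ioc 0 H).filter fun t => W.Coprime (b + t)) : ℝ) ≤
        W.totient * ((H / W : ℕ) + 1) := by exact_mod_cast h3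
      have h6 : ((H / W : ℕ) : ℝ) ≤ (H : ℝ) / W := Nat.cast_div_le
      refine h5.trans ?_
      gcongr
    calc _ ≤ mertensProd w * (W.totient * (H / W + 1)) := by gcongr
      _ = (mertensProd w * W.totient) * (H / W + 1) := by ring
      _ = W * (H / W + 1) := by rw [mertensProd_mul_totient]
      _ = _ := by field_simp
  rw [← Nat.cast_sum, h1]
  push_cast
  rw [Finset.mul_sum]
  calc _ ≤ ∑ b ∈ range W, ((H : ℝ) + W) ^ r := by
        refine Finset.sum_le_sum fun b _ => ?_
        rw [← mul_pow]
        have := h2 b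
        gcongr
    _ = _ := by rw [Finset.sum_const, card_range, nsmul_eq_mul]

/-- The number of prime translates, summed over all tuples with distinct entries up to `H`. -/
theorem sum_card_prime_translates_le {r : ℕ} (hr : 0 < r) {w : ℕ} (hw : r ≤ w) {R : ℕ}
    (hwR : w ≤ R) (N H : ℕ) :
    (∑ h ∈ tuples r H with Function.Injective h, (#{n ∈ range N | ∀ i, (n + h i).Prime} : ℝ)) ≤
      (H : ℝ) ^ r * (R + 1 + primorial w * (R * (1 + Real.log R) ^ r) ^ 2) +
      ((N : ℝ) + primorial w) * (r.factorial / Real.log (R + 1) ^ r) *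
        (((H : ℝ) + primorial w) ^ r + 2 * (H : ℝ) ^ r *
          (mertensProd w ^ r * (Real.exp (2 * 3 ^ (r * (r * r)) / w) - 1))) := by
  have hR : 1 ≤ R := by omega
  set W := primorial w with hW
  have hW0 : 0 < W := primorial_pos w
  have hWr : (0 : ℝ) < W := by exact_mod_cast hW0
  have hV := zero_le_one.trans (one_le_mertensProd w)
  set V := mertensProd w
  set Err := (R * (1 + Real.log R) ^ r) ^ 2
  have hErr : 0 ≤ Err := sq_nonneg _
  have hlog : 0 ≤ Real.log (R + 1) := Real.log_nonneg (by
    have : (0 : ℝ) ≤ R := Nat.cast_nonneg R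
    linarith)
  set c := r.factorial / Real.log (R + 1) ^ r
  have hc : 0 ≤ c := by positivity
  have hg : ∀ h : Fin r → ℕ, (#(goodClasses W h) : ℝ) ≤ W := fun h => by
    have : #(goodClasses W h) ≤ W := (card_filter_le _ _).trans (by rw [card_range])
    exact_mod_cast this
  have hE : ∀ h : Fin r → ℕ, 0 ≤ diffFactor w h - 1 := fun h => by
    linarith [one_le_diffFactor w h]
  -- Write `diffFactor` as `1 + (diffFactor - 1)`: the first part is averaged over good classes, and
  -- in the second the number of good classes is bounded trivially by `W`.
  have hterm : ∀ h ∈ (tuples r H).filter (fun h => Function.Injective h),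
      (#{n ∈ range N | ∀ i, (n + h i).Prime} : ℝ) ≤ (R + 1 + W * Err) +
        ((N : ℝ) / W + 1) * c * (V ^ r * #(goodClasses W h) + V ^ r * W * (diffFactor w h - 1)) := by
    intro h hh
    refine (card_prime_translates_le hr hw (mem_filter.1 hh).2 hR hwR N).trans ?_
    have h1 : (#(goodClasses W h) : ℝ) * Err ≤ W * Err := by
      have := hg h
      gcongr
    have h2 : (#(goodClasses W h) : ℝ) * (diffFactor w h - 1) ≤ W * (diffFactor w h - 1) :=
      mul_le_mul_of_nonneg_right (hg h) (hE h)
    have h3 : 0 ≤ ((N : ℝ) / W + 1) * c * V ^ r := by positivity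
    have h4 := mul_le_mul_of_nonneg_left h2 h3
    have h5 : (r.factorial * V ^ r * diffFactor w h / Real.log (R + 1) ^ r) =
        c * V ^ r * diffFactor w h := by simp only [c]; ring
    rw [h5]
    linarith
  have hnn : ∀ h : Fin r → ℕ, 0 ≤ (R + 1 + W * Err) +
        ((N : ℝ) / W + 1) * c * (V ^ r * #(goodClasses W h) + V ^ r * W * (diffFactor w h - 1)) := by
    intro h
    have := hE h
    positivity
  have hsum : ∑ h ∈ tuples r H, (diffFactor w h - 1) ≤
      2 * (H : ℝ) ^ r * (Real.exp (2 * 3 ^ (r * (r * r)) / w) - 1) :=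
    sum_diffFactor_sub_one_le hr (by omega) H
  have hgood := sum_card_goodClasses_le r w H
  calc _ ≤ ∑ h ∈ tuples r H with Function.Injective h, ((R + 1 + W * Err) + ((N : ℝ) / W + 1) * c *
          (V ^ r * #(goodClasses W h) + V ^ r * W * (diffFactor w h - 1))) :=
        Finset.sum_le_sum hterm
    _ ≤ ∑ h ∈ tuples r H, ((R + 1 + W * Err) + ((N : ℝ) / W + 1) * c *
          (V ^ r * #(goodClasses W h) + V ^ r * W * (diffFactor w h - 1))) :=
        Finset.sum_le_sum_of_subset_of_nonneg (filter_subset _ _) fun h _ _ => hnn h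
    _ = (H : ℝ) ^ r * (R + 1 + W * Err) + ((N : ℝ) / W + 1) * c *
          (V ^ r * ∑ h ∈ tuples r H, (#(goodClasses W h) : ℝ) +
            V ^ r * W * ∑ h ∈ tuples r H, (diffFactor w h - 1)) := by
        rw [Finset.sum_add_distrib, Finset.sum_const, card_tuples, nsmul_eq_mul,
          ← Finset.mul_sum, Finset.sum_add_distrib, ← Finset.mul_sum, ← Finset.mul_sum]
        push_cast
        rfl
    _ ≤ (H : ℝ) ^ r * (R + 1 + W * Err) + ((N : ℝ) / W + 1) * c *
          (W * ((H : ℝ) + W) ^ r + V ^ r * W *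
            (2 * (H : ℝ) ^ r * (Real.exp (2 * 3 ^ (r * (r * r)) / w) - 1))) := by
        gcongr
    _ = _ := by field_simp

/-! ### Moments of the number of primes in short intervals -/

/-- The number of primes in `(n, n + H]`. -/
def primeWindow (H n : ℕ) : ℕ := #{t ∈ Ioc 0 H | (n + t).Prime}

theorem card_injective_piFinset (r : ℕ) (A : Finset ℕ) :
    #{h ∈ Fintype.piFinset fun _ : Fin r => A | Function.Injective h} = (#A).descFactorial r := by
  have : Fintype.card (Fin r ↪ A) = (#A).descFactorial r := by
    rw [Fintype.card_embedding_eq, Fintype.card_coe, Fintype.card_fin]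
  rw [← this, ← Finset.card_univ]
  symm
  refine Finset.card_bij (fun f _ i => (f i : ℕ)) ?_ ?_ ?_
  · intro f _
    rw [mem_filter, Fintype.mem_piFinset]
    exact ⟨fun i => (f i).2, Subtype.val_injective.comp f.injective⟩
  · intro f _ g _ hfg
    ext i
    exact congrFun hfg i
  · intro h hh
    rw [mem_filter, Fintype.mem_piFinset] at hh
    exact ⟨⟨fun i => ⟨h i, hh.1 i⟩, fun i j hij => hh.2 (congrArg Subtype.val hij)⟩,
      mem_univ _, rfl⟩

theorem sum_descFactorial_primeWindow (r N H : ℕ) :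
    ∑ n ∈ range N, (primeWindow H n).descFactorial r =
      ∑ h ∈ tuples r H with Function.Injective h, #{n ∈ range N | ∀ i, (n + h i).Prime} := by
  have hcf : ∀ h : Fin r → ℕ, #{n ∈ range N | ∀ i, (n + h i).Prime} =
      ∑ n ∈ range N, if ∀ i, (n + h i).Prime then 1 else 0 := fun h => Finset.card_filter _ _
  simp only [hcf]
  rw [Finset.sum_comm]
  refine Finset.sum_congr rfl fun n _ => ?_
  rw [← Finset.card_filter, Finset.filter_filter, primeWindow, ← card_injective_piFinset]
  congr 1
  ext h
  simp only [tuples, mem_filter, Fintype.mem_piFinset]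
  constructor
  · exact fun hh => ⟨fun i => (hh.1 i).1, hh.2, fun i => (hh.1 i).2⟩
  · exact fun hh => ⟨fun i => ⟨hh.1 i, hh.2.2 i⟩, hh.2.1⟩

/-- Powers in terms of falling factorials. -/
theorem pow_eq_sum_stirlingSecond_mul_descFactorial (n k : ℕ) :
    n ^ k = ∑ r ∈ range (k + 1), k.stirlingSecond r * n.descFactorial r := by
  induction k with
  | zero => simp
  | succ k ih =>
    have hmul : ∀ r, n * n.descFactorial r = n.descFactorial (r + 1) + r * n.descFactorial r := by
      intro r
      rw [Nat.descFactorial_succ, ← add_mul]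
      rcases le_or_gt r n with h | h
      · rw [Nat.sub_add_cancel h]
      · rw [Nat.descFactorial_of_lt h]; simp
    have h1 : n ^ (k + 1) = ∑ r ∈ range (k + 1), (k.stirlingSecond r * n.descFactorial (r + 1) +
        r * k.stirlingSecond r * n.descFactorial r) := by
      rw [pow_succ, ih, Finset.sum_mul]
      refine Finset.sum_congr rfl fun r _ => ?_
      rw [mul_assoc, mul_comm _ n, hmul]
      ring
    have h2 : ∑ r ∈ range (k + 1), r * k.stirlingSecond r * n.descFactorial r =
        ∑ r ∈ range (k + 1),
          (r + 1) * k.stirlingSecond (r + 1) * n.descFactorial (r + 1) := by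
      rw [Finset.sum_range_succ' _ k, Finset.sum_range_succ _ k,
        Nat.stirlingSecond_eq_zero_of_lt (Nat.lt_succ_self k)]
      simp
    rw [h1, Finset.sum_range_succ' _ (k + 1), Finset.sum_add_distrib, h2,
      ← Finset.sum_add_distrib, Nat.stirlingSecond_succ_zero, zero_mul, add_zero]
    refine Finset.sum_congr rfl fun r _ => ?_
    rw [Nat.stirlingSecond_succ_succ]
    ring

end PrimeMoments

/-! ### Asymptotics -/

namespace PrimeMoments

open Finset Filter Topology

theorem tendsto_sqrt_div_log_pow (m : ℕ) :
    Tendsto (fun X : ℝ => √X / Real.log X ^ m) atTop atTop := by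
  have h1 : Tendsto (fun X : ℝ => Real.log X ^ m / √X) atTop (𝓝 0) := by
    have h2 : Tendsto (fun x : ℝ => Real.log x ^ m / x) atTop (𝓝 0) :=
      Real.isLittleO_pow_log_id_atTop.tendsto_div_nhds_zero
    have h3 := (h2.comp Real.tendsto_sqrt_atTop).const_mul ((2 : ℝ) ^ m)
    rw [mul_zero] at h3
    refine h3.congr' ?_
    filter_upwards [eventually_ge_atTop 0] with X hX
    simp only [Function.comp]
    rw [Real.log_sqrt hX, div_pow, mul_div_assoc', mul_div_cancel₀ _ (by positivity)]
  have hpos : ∀ᶠ X : ℝ in atTop, 0 < Real.log X ^ m / √X := by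
    filter_upwards [eventually_gt_atTop 1] with X hX
    have := Real.log_pos hX
    positivity
  have h4 := (tendsto_nhdsWithin_iff.2 ⟨h1, hpos⟩).inv_tendsto_nhdsGT_zero
  refine h4.congr fun X => ?_
  simp [inv_div]

theorem tendsto_log_log_div_log :
    Tendsto (fun X : ℝ => Real.log (Real.log X) / Real.log X) atTop (𝓝 0) :=
  Real.isLittleO_log_id_atTop.tendsto_div_nhds_zero.comp Real.tendsto_log_atTop

/-- Falling factorial moments of the number of primes in intervals of length `y log X`. The level
of the sieve is `√X / (log X)^{2r}`. -/
theorem eventually_sum_descFactorial_le {r : ℕ} (hr : 0 < r) {y : ℝ} (hy : 0 < y) {ε : ℝ}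
    (hε : 0 < ε) : ∀ᶠ X : ℝ in atTop,
      (∑ n ∈ range (⌊X⌋₊ + 1), ((primeWindow ⌊y * Real.log X⌋₊ n).descFactorial r : ℝ)) ≤
        (2 ^ r * r.factorial * y ^ r + ε) * X := by
  have hfac : (0 : ℝ) < r.factorial := by exact_mod_cast r.factorial_pos
  set η : ℝ := ε / (2 ^ r * r.factorial * y ^ r * 4) with hη
  have hη0 : 0 < η := by positivity
  obtain ⟨w, hrw, hwη⟩ := exists_mertensProd_pow_mul_le r
    (C := 2 * 3 ^ (r * (r * r))) (by positivity) hη0 r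
  set W : ℝ := (primorial w : ℝ) with hW
  have hW0 : 0 < W := by
    have := primorial_pos w
    rw [hW]; exact_mod_cast this
  -- `L * q X` is the logarithm of the sieve level, so the limit `1 / 2` of `q` produces `2 ^ r`.
  set q : ℝ → ℝ := fun X => 1 / 2 - 2 * r * (Real.log (Real.log X) / Real.log X) with hq
  have hqlim : Tendsto q atTop (𝓝 (1 / 2)) := by
    have := (tendsto_log_log_div_log.const_mul (2 * (r : ℝ))).const_sub (1 / 2)
    rw [mul_zero, sub_zero] at this
    exact this
  have hloginv : ∀ c : ℝ, Tendsto (fun X : ℝ => c / Real.log X) atTop (𝓝 0) := fun c =>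
    tendsto_const_nhds.div_atTop Real.tendsto_log_atTop
  set f : ℝ → ℝ := fun X => 2 * y ^ r / √X + W * y ^ r * 4 ^ r / Real.log X ^ r +
    (1 + (1 + W) / X) * (r.factorial / q X ^ r) * ((y + W / Real.log X) ^ r + 2 * y ^ r * η)
    with hf
  have hflim : Tendsto f atTop
      (𝓝 (0 + 0 + (1 + 0) * (r.factorial / (1 / 2) ^ r) * ((y + 0) ^ r + 2 * y ^ r * η))) := by
    refine ((tendsto_const_nhds.div_atTop Real.tendsto_sqrt_atTop).add
      (tendsto_const_nhds.div_atTop ?_)).add ((((tendsto_const_nhds.div_atTop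
        tendsto_id).const_add 1).mul (tendsto_const_nhds.div (hqlim.pow r) (by positivity))).mul
        ((((hloginv W).const_add y).pow r).add tendsto_const_nhds))
    exact (tendsto_pow_atTop hr.ne').comp Real.tendsto_log_atTop
  have hlimlt : 0 + 0 + (1 + 0) * (r.factorial / (1 / 2) ^ r) * ((y + 0) ^ r + 2 * y ^ r * η) <
      2 ^ r * r.factorial * y ^ r + ε := by
    have : 0 + 0 + (1 + 0) * (r.factorial / (1 / 2) ^ r) * ((y + 0) ^ r + 2 * y ^ r * η) =
        2 ^ r * r.factorial * y ^ r + ε / 2 := by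
      rw [hη, one_div, inv_pow]
      field_simp
      ring
    rw [this]; linarith
  have hbig := tendsto_sqrt_div_log_pow (2 * r)
  filter_upwards [hflim.eventually (eventually_lt_nhds hlimlt),
    hbig.eventually_ge_atTop (w : ℝ), hbig.eventually_ge_atTop 1,
    hqlim.eventually (eventually_gt_nhds (by norm_num : (0 : ℝ) < 1 / 2)),
    Real.tendsto_log_atTop.eventually_ge_atTop 1, eventually_ge_atTop 1]
    with X hX1 hX2 hX3 hX4 hX5 hX6
  set L := Real.log X with hL
  have hL0 : 0 < L := by linarith
  have hX0 : 0 < X := by linarith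
  have hsq : √X * √X = X := Real.mul_self_sqrt hX0.le
  have hs0 : 0 < √X := Real.sqrt_pos.2 hX0
  set T : ℝ := √X / L ^ (2 * r) with hT
  set R : ℕ := ⌊T⌋₊ with hR
  set H : ℕ := ⌊y * L⌋₊ with hH
  have hT0 : 0 < T := by linarith
  have hRT : (R : ℝ) ≤ T := Nat.floor_le hT0.le
  have hTR : T < R + 1 := Nat.lt_floor_add_one T
  have hwR : w ≤ R := Nat.le_floor hX2
  have hR1 : (1 : ℝ) ≤ R := by
    have : 1 ≤ R := by omega
    exact_mod_cast this
  have hHy : (H : ℝ) ≤ y * L := Nat.floor_le (by positivity)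
  have hH0 : (0 : ℝ) ≤ H := Nat.cast_nonneg _
  have hN : ((⌊X⌋₊ + 1 : ℕ) : ℝ) ≤ X + 1 := by
    push_cast
    linarith [Nat.floor_le hX0.le]
  have hLpow : 1 ≤ L ^ r := one_le_pow₀ hX5
  have hTX : T ≤ √X := div_le_self hs0.le (one_le_pow₀ hX5)
  have hlogR : 1 + Real.log R ≤ 2 * L := by
    have h1 : (R : ℝ) ≤ X := by
      have : √X ≤ X := by nlinarith [Real.one_le_sqrt.2 hX6]
      linarith
    have : Real.log R ≤ L := Real.log_le_log (by linarith) h1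
    linarith
  have hlogR0 : 0 ≤ Real.log R := Real.log_nonneg hR1
  have hlogq : L * q X ≤ Real.log (R + 1) := by
    have h1 : Real.log T ≤ Real.log (R + 1) := Real.log_le_log hT0 hTR.le
    have h2 : Real.log T = L * q X := by
      rw [hT, Real.log_div hs0.ne' (by positivity), Real.log_sqrt hX0.le, Real.log_pow, hq, ← hL]
      simp only [← hL]
      push_cast
      field_simp
    linarith
  have hmain := sum_card_prime_translates_le hr hrw hwR (⌊X⌋₊ + 1) H
  have hsum : (∑ n ∈ range (⌊X⌋₊ + 1), ((primeWindow H n).descFactorial r : ℝ)) =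
      ∑ h ∈ tuples r H with Function.Injective h,
        (#{n ∈ range (⌊X⌋₊ + 1) | ∀ i, (n + h i).Prime} : ℝ) := by
    exact_mod_cast sum_descFactorial_primeWindow r (⌊X⌋₊ + 1) H
  rw [hsum]
  refine hmain.trans ?_
  have hfX : f X * X ≤ (2 ^ r * r.factorial * y ^ r + ε) * X :=
    mul_le_mul_of_nonneg_right hX1.le hX0.le
  refine le_trans ?_ hfX
  rw [hf]
  simp only [← hL, ← hW]
  have hA : (H : ℝ) ^ r * (R + 1) ≤ 2 * y ^ r / √X * X := by
    have e1 : 2 * y ^ r / √X * X = 2 * y ^ r * √X := by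
      rw [div_mul_eq_mul_div, div_eq_iff hs0.ne', mul_assoc _ √X, hsq]
    rw [e1]
    calc (H : ℝ) ^ r * (R + 1) ≤ (y * L) ^ r * (2 * T) := by
          have : (R : ℝ) + 1 ≤ 2 * T := by linarith
          gcongr
      _ = 2 * y ^ r * (√X / L ^ r) := by
          rw [hT, mul_pow, two_mul r, pow_add]; field_simp
      _ ≤ 2 * y ^ r * √X := by
          have := div_le_self hs0.le hLpow
          gcongr
  have hB : (H : ℝ) ^ r * (W * (R * (1 + Real.log R) ^ r) ^ 2) ≤
      W * y ^ r * 4 ^ r / L ^ r * X := by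
    calc (H : ℝ) ^ r * (W * (R * (1 + Real.log R) ^ r) ^ 2)
        ≤ (y * L) ^ r * (W * (T * (2 * L) ^ r) ^ 2) := by gcongr
      _ = W * y ^ r * 4 ^ r / L ^ r * (√X * √X) := by
          rw [hT, show (4 : ℝ) = 2 * 2 by norm_num]
          simp only [mul_pow, two_mul r, pow_add]
          field_simp
      _ = _ := by rw [hsq]
  have hC : (((⌊X⌋₊ + 1 : ℕ) : ℝ) + W) * (r.factorial / Real.log (R + 1) ^ r) *
        (((H : ℝ) + W) ^ r + 2 * (H : ℝ) ^ r *
          (mertensProd w ^ r * (Real.exp (2 * 3 ^ (r * (r * r)) / w) - 1))) ≤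
      (1 + (1 + W) / X) * (r.factorial / q X ^ r) * ((y + W / L) ^ r + 2 * y ^ r * η) * X := by
    have hexp0 : 0 ≤ mertensProd w ^ r * (Real.exp (2 * 3 ^ (r * (r * r)) / w) - 1) := by
      refine mul_nonneg (pow_nonneg (zero_le_one.trans (one_le_mertensProd w)) r) ?_
      have : (0 : ℝ) ≤ 2 * 3 ^ (r * (r * r)) / w := by positivity
      linarith [Real.one_le_exp this]
    have hlogR1 : 0 < Real.log (R + 1) := lt_of_lt_of_le (by positivity) hlogq
    calc _ ≤ (X + 1 + W) * (r.factorial / (L * q X) ^ r) *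
          ((y * L + W) ^ r + 2 * (y * L) ^ r * η) := by gcongr
      _ = _ := by
          have e1 : y * L + W = L * (y + W / L) := by field_simp
          rw [e1, mul_pow, mul_pow, mul_pow]
          field_simp
          ring
  calc _ = (H : ℝ) ^ r * (R + 1) + (H : ℝ) ^ r * (W * (R * (1 + Real.log R) ^ r) ^ 2) +
        (((⌊X⌋₊ + 1 : ℕ) : ℝ) + W) * (r.factorial / Real.log (R + 1) ^ r) *
        (((H : ℝ) + W) ^ r + 2 * (H : ℝ) ^ r *
          (mertensProd w ^ r * (Real.exp (2 * 3 ^ (r * (r * r)) / w) - 1))) := by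
        rw [mul_add]
    _ ≤ _ := add_le_add (add_le_add hA hB) hC
    _ = _ := by ring

/-- Moments of the number of primes in intervals of length `y log X`. -/
theorem eventually_sum_primeWindow_pow_le {l : ℕ} (hl : 0 < l) {y : ℝ} (hy : 0 < y) {ε : ℝ}
    (hε : 0 < ε) : ∀ᶠ X : ℝ in atTop,
      (∑ n ∈ range (⌊X⌋₊ + 1), (primeWindow ⌊y * Real.log X⌋₊ n : ℝ) ^ l) ≤ (P l y + ε) * X := by
  -- The admissible error is shared among the falling factorials in proportion to their weights.
  set c : ℝ := ∑ r ∈ Icc 1 l, (l.stirlingSecond r : ℝ) with hc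
  have hc0 : 0 ≤ c := by positivity
  have hall : ∀ᶠ X : ℝ in atTop, ∀ r ∈ Icc 1 l,
      (∑ n ∈ range (⌊X⌋₊ + 1), ((primeWindow ⌊y * Real.log X⌋₊ n).descFactorial r : ℝ)) ≤
        (2 ^ r * r.factorial * y ^ r + ε / (c + 1)) * X := by
    rw [Filter.eventually_all_finset]
    exact fun r hr => eventually_sum_descFactorial_le (mem_Icc.1 hr).1 hy (by positivity)
  filter_upwards [hall, eventually_ge_atTop 0] with X hX hX0
  set H := ⌊y * Real.log X⌋₊
  have hpow : ∀ n : ℕ, (primeWindow H n : ℝ) ^ l = ∑ r ∈ Icc 1 l,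
      (l.stirlingSecond r : ℝ) * ((primeWindow H n).descFactorial r : ℝ) := by
    intro n
    have h1 := pow_eq_sum_stirlingSecond_mul_descFactorial (primeWindow H n) l
    have h2 : range (l + 1) = insert 0 (Icc 1 l) := by
      ext r
      simp only [mem_range, mem_insert, mem_Icc]
      omega
    obtain ⟨l', rfl⟩ := Nat.exists_eq_succ_of_ne_zero hl.ne'
    rw [h2, Finset.sum_insert (by simp), Nat.stirlingSecond_succ_zero, zero_mul, zero_add] at h1
    exact_mod_cast h1
  calc ∑ n ∈ range (⌊X⌋₊ + 1), (primeWindow H n : ℝ) ^ l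
      = ∑ r ∈ Icc 1 l, (l.stirlingSecond r : ℝ) *
          ∑ n ∈ range (⌊X⌋₊ + 1), ((primeWindow H n).descFactorial r : ℝ) := by
        simp only [hpow, Finset.mul_sum]
        rw [Finset.sum_comm]
    _ ≤ ∑ r ∈ Icc 1 l, (l.stirlingSecond r : ℝ) *
          ((2 ^ r * r.factorial * y ^ r + ε / (c + 1)) * X) := by
        gcongr with r hr
        exact hX r hr
    _ = (P l y + c * (ε / (c + 1))) * X := by
        rw [P, hc, Finset.sum_mul, ← Finset.sum_add_distrib, Finset.sum_mul]
        exact Finset.sum_congr rfl fun r _ => by ring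
    _ ≤ _ := by
        have : c * (ε / (c + 1)) ≤ ε := by
          rw [mul_div_assoc', div_le_iff₀ (by positivity)]
          nlinarith
        gcongr

end PrimeMoments

/-! ### From intervals starting at integers to intervals starting at primes -/

namespace PrimeMoments

open Finset Filter Topology

theorem primeWindow_le (H n : ℕ) : primeWindow H n ≤ H := by
  refine (card_filter_le _ _).trans (le_of_eq ?_)
  simp

theorem floor_natCast_add_nonneg (p : ℕ) {a : ℝ} (ha : 0 ≤ a) : ⌊(p : ℝ) + a⌋₊ = p + ⌊a⌋₊ := by
  rw [add_comm, Nat.floor_add_natCast ha, add_comm]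

theorem primePi_sub_primePi (p : ℕ) {a : ℝ} (ha : 0 ≤ a) :
    primePi ((p : ℝ) + a) - primePi (p : ℝ) = primeWindow ⌊a⌋₊ p := by
  rw [primePi, primePi, floor_natCast_add_nonneg p ha, Nat.floor_natCast]
  set A := ⌊a⌋₊
  have h1 : Nat.primeCounting (p + A) = Nat.primeCounting p + primeWindow A p := by
    change Nat.count Nat.Prime (p + A + 1) = Nat.count Nat.Prime (p + 1) + primeWindow A p
    rw [show p + A + 1 = (p + 1) + A by ring, Nat.count_add, Nat.count_eq_card_filter_range _ A,
      primeWindow]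
    congr 1
    refine Finset.card_bij (fun k _ => k + 1) ?_ (fun a _ b _ h => Nat.succ_injective h) ?_
    · intro k hk
      simp only [mem_filter, mem_range, mem_Ioc] at hk ⊢
      exact ⟨by omega, by rw [add_comm k, ← add_assoc]; exact hk.2⟩
    · intro t ht
      simp only [mem_filter, mem_Ioc] at ht
      refine ⟨t - 1, ?_, by omega⟩
      simp only [mem_filter, mem_range]
      exact ⟨by omega, by rw [show p + 1 + (t - 1) = p + t by omega]; exact ht.2⟩
  rw [h1]
  push_cast
  ring

/-- A window `(p, p + A]` starting at a prime `p ∈ (n, n + B]` lies in `(n, n + H]`. Counting the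
pairs `(n, p)` gives a factor `B` for each prime `p ≥ B`. -/
theorem mul_sum_primeWindow_pow_le {A B H : ℕ} (hABH : A + B ≤ H) (N k : ℕ) :
    B * ∑ p ∈ Nat.primesLE N, primeWindow A p ^ k ≤
      ∑ n ∈ range (N + 1), primeWindow H n ^ (k + 1) + B * (B * A ^ k) := by
  have hsplit : ∀ p ∈ Nat.primesLE N, B * primeWindow A p ^ k ≤
      (∑ n ∈ range (N + 1), if n < p ∧ p ≤ n + B then primeWindow A p ^ k else 0) +
        if p < B then B * A ^ k else 0 := by
    intro p hp
    rcases lt_or_ge p B with hpB | hpB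
    · rw [if_pos hpB]
      have := Nat.pow_le_pow_left (primeWindow_le A p) k
      have := Nat.mul_le_mul_left B this
      omega
    · -- For `p ≥ B` the window starting points `p - B, …, p - 1` are all natural numbers.
      rw [if_neg (by omega), add_zero, ← Finset.sum_filter, Finset.sum_const, smul_eq_mul]
      refine Nat.mul_le_mul_right _ ?_
      have hpN := Nat.le_of_mem_primesLE hp
      have : #(Ico (p - B) p) = B := by rw [Nat.card_Ico]; omega
      calc B = #(Ico (p - B) p) := this.symm
        _ ≤ _ := by
          refine card_le_card fun n hn => ?_
          simp only [mem_Ico, mem_filter, mem_range] at hn ⊢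
          omega
  have hwin : ∀ n ∈ range (N + 1), (∑ p ∈ Nat.primesLE N,
      if n < p ∧ p ≤ n + B then primeWindow A p ^ k else 0) ≤ primeWindow H n ^ (k + 1) := by
    intro n _
    rw [← Finset.sum_filter, pow_succ']
    have hle : ∀ p ∈ (Nat.primesLE N).filter (fun p => n < p ∧ p ≤ n + B),
        primeWindow A p ^ k ≤ primeWindow H n ^ k := by
      intro p hp
      rw [mem_filter] at hp
      refine Nat.pow_le_pow_left ?_ k
      refine card_le_card_of_injOn (fun t => p - n + t) ?_ fun a _ b _ h => Nat.add_left_cancel h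
      intro t ht
      simp only [coe_filter, mem_Ioc, Set.mem_ofPred_eq] at ht ⊢
      refine ⟨by omega, ?_⟩
      rw [show n + (p - n + t) = p + t by omega]
      exact ht.2
    refine (Finset.sum_le_card_nsmul _ _ _ hle).trans ?_
    rw [smul_eq_mul]
    refine Nat.mul_le_mul_right _ ?_
    refine card_le_card_of_injOn (fun p => p - n) ?_ ?_
    · intro p hp
      simp only [coe_filter, Set.mem_ofPred_eq, Nat.mem_primesLE, mem_Ioc] at hp ⊢
      refine ⟨by omega, ?_⟩
      rw [show n + (p - n) = p by omega]
      exact hp.1.2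
    · intro p hp q hq h
      simp only [coe_filter, Set.mem_ofPred_eq] at hp hq h
      omega
  calc B * ∑ p ∈ Nat.primesLE N, primeWindow A p ^ k
      ≤ ∑ p ∈ Nat.primesLE N,
          ((∑ n ∈ range (N + 1), if n < p ∧ p ≤ n + B then primeWindow A p ^ k else 0) +
            if p < B then B * A ^ k else 0) := by
        rw [Finset.mul_sum]
        exact Finset.sum_le_sum hsplit
    _ ≤ _ := by
        rw [Finset.sum_add_distrib, Finset.sum_comm]
        refine add_le_add (Finset.sum_le_sum hwin) ?_
        rw [← Finset.sum_filter, Finset.sum_const, smul_eq_mul]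
        refine Nat.mul_le_mul_right _ ?_
        calc #{p ∈ Nat.primesLE N | p < B} ≤ #(range B) :=
              card_le_card fun p hp => mem_range.2 (mem_filter.1 hp).2
          _ = B := card_range B

theorem tendsto_log_pow_div_sqrt (c : ℝ) (m : ℕ) :
    Tendsto (fun X : ℝ => c * (Real.log X ^ m / √X)) atTop (𝓝 0) := by
  have := (tendsto_sqrt_div_log_pow m).inv_tendsto_atTop.const_mul c
  rw [mul_zero] at this
  refine this.congr fun X => ?_
  simp [inv_div]

theorem P_nonneg (k : ℕ) {y : ℝ} (hy : 0 ≤ y) : 0 ≤ P k y :=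
  Finset.sum_nonneg fun _ _ => by positivity

/-- Moments of the number of primes in intervals of length `λ log X` starting at a prime. -/
theorem eventually_sum_primes_primeWindow_pow_le (k : ℕ) {ω lam ε : ℝ} (hω : 1 < ω)
    (hlam : 0 < lam) (hε : 0 < ε) : ∀ᶠ X : ℝ in atTop,
      ∑ p ∈ Nat.primesLE ⌊X⌋₊, (primeWindow ⌊lam * Real.log X⌋₊ p : ℝ) ^ k ≤
        (R (k + 1) ω lam + ε) * (X / Real.log X) := by
  set b := (ω - 1) * lam with hb
  have hb0 : 0 < b := mul_pos (by linarith) hlam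
  set ε' := ε * b / 2 with hε'
  have hε'0 : 0 < ε' := by positivity
  have hy : 0 < ω * lam := by positivity
  set Q := P (k + 1) (ω * lam) + ε' with hQ
  have hQ0 : 0 ≤ Q := add_nonneg (P_nonneg _ hy.le) hε'0.le
  have hmom := eventually_sum_primeWindow_pow_le (Nat.succ_pos k) hy hε'0
  set g : ℝ → ℝ := fun X => Q / (b - 1 / Real.log X) +
    b * lam ^ k * (Real.log X ^ (k + 2) / √X) with hg
  have hglim : Tendsto g atTop (𝓝 (Q / (b - 0) + 0)) := by
    refine (tendsto_const_nhds.div (tendsto_const_nhds.sub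
      (tendsto_const_nhds.div_atTop Real.tendsto_log_atTop)) (by linarith)).add
      (tendsto_log_pow_div_sqrt _ _)
  have hlt : Q / (b - 0) + 0 < R (k + 1) ω lam + ε := by
    rw [R, ← hb, sub_zero, add_zero, hQ, hε', add_div]
    have : ε * b / 2 / b = ε / 2 := by field_simp
    rw [this]; linarith
  filter_upwards [hmom, hglim.eventually (eventually_lt_nhds hlt),
    (Real.tendsto_log_atTop.const_mul_atTop hb0).eventually_gt_atTop 1,
    Real.tendsto_log_atTop.eventually_gt_atTop 0, eventually_ge_atTop 1]
    with X hX1 hX2 hX3 hX4 hX5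
  set L := Real.log X with hL
  set A := ⌊lam * L⌋₊ with hA
  set B := ⌊b * L⌋₊ with hB
  set H := ⌊ω * lam * L⌋₊ with hH
  have hX0 : 0 < X := by linarith
  have hAle : (A : ℝ) ≤ lam * L := Nat.floor_le (by positivity)
  have hBle : (B : ℝ) ≤ b * L := Nat.floor_le (by positivity)
  have hBge : b * L - 1 < B := Nat.sub_one_lt_floor _
  have hB0 : (0 : ℝ) < B := by linarith
  have hABH : A + B ≤ H := by
    refine Nat.le_floor ?_
    push_cast
    calc (A : ℝ) + B ≤ lam * L + b * L := add_le_add hAle hBle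
      _ = _ := by rw [hb]; ring
  have hnat := mul_sum_primeWindow_pow_le hABH ⌊X⌋₊ k
  have hreal : (B : ℝ) * ∑ p ∈ Nat.primesLE ⌊X⌋₊, (primeWindow A p : ℝ) ^ k ≤
      (∑ n ∈ range (⌊X⌋₊ + 1), (primeWindow H n : ℝ) ^ (k + 1)) + B * (B * A ^ k) := by
    exact_mod_cast hnat
  have hsqrt : √X ≤ X := by
    have := Real.mul_self_sqrt hX0.le
    nlinarith [Real.one_le_sqrt.2 hX5]
  have hs0 : 0 < √X := Real.sqrt_pos.2 hX0
  have h1 : ∑ p ∈ Nat.primesLE ⌊X⌋₊, (primeWindow A p : ℝ) ^ k ≤ Q * X / B + B * A ^ k := by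
    rw [div_add' _ _ _ hB0.ne', le_div_iff₀ hB0]
    linarith
  have h2 : Q * X / B ≤ Q / (b - 1 / L) * (X / L) := by
    have h3 : L * (b - 1 / L) = b * L - 1 := by field_simp
    have h4 : 0 < b - 1 / L := by
      by_contra hneg
      nlinarith [mul_nonneg hX4.le (neg_nonneg.2 (not_lt.1 hneg))]
    calc Q * X / B ≤ Q * X / (L * (b - 1 / L)) := by
          rw [h3]
          gcongr
      _ = _ := by field_simp
  have h5 : (B : ℝ) * A ^ k ≤ b * lam ^ k * (L ^ (k + 2) / √X) * (X / L) := by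
    have hXs : 1 ≤ X / √X := (one_le_div hs0).2 hsqrt
    calc (B : ℝ) * A ^ k ≤ b * L * (lam * L) ^ k := by gcongr
      _ ≤ b * L * (lam * L) ^ k * (X / √X) := le_mul_of_one_le_right (by positivity) hXs
      _ = _ := by rw [mul_pow, pow_add]; field_simp
  calc _ ≤ Q * X / B + B * A ^ k := h1
    _ ≤ g X * (X / L) := by rw [hg]; simp only [← hL]; linarith
    _ ≤ _ := by gcongr

/-! ### Weighting by the von Mangoldt function -/

/-- The contribution to the sum of `Λ` over `(n, n + H]` of the integers that are not prime. -/
noncomputable def primePowWindow (H n : ℕ) : ℝ :=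
  ∑ t ∈ Ioc 0 H with ¬ (n + t).Prime, ArithmeticFunction.vonMangoldt (n + t)

theorem primePowWindow_nonneg (H n : ℕ) : 0 ≤ primePowWindow H n :=
  Finset.sum_nonneg fun _ _ => ArithmeticFunction.vonMangoldt_nonneg

theorem psi_sub_psi (p : ℕ) {a : ℝ} (ha : 0 ≤ a) :
    Chebyshev.psi ((p : ℝ) + a) - Chebyshev.psi (p : ℝ) =
      ∑ t ∈ Ioc 0 ⌊a⌋₊, ArithmeticFunction.vonMangoldt (p + t) := by
  rw [Chebyshev.psi, Chebyshev.psi, floor_natCast_add_nonneg p ha, Nat.floor_natCast]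
  set A := ⌊a⌋₊
  rw [← Finset.sum_Ioc_consecutive _ (Nat.zero_le p) (Nat.le_add_right p A), add_sub_cancel_left]
  refine Finset.sum_bij' (fun n _ => n - p) (fun t _ => p + t) ?_ ?_ ?_ ?_ ?_
  · intro n hn; rw [mem_Ioc] at hn ⊢; omega
  · intro t ht; rw [mem_Ioc] at ht ⊢; omega
  · intro n hn; rw [mem_Ioc] at hn; omega
  · intro t _; omega
  · intro n hn
    rw [mem_Ioc] at hn
    rw [Nat.add_sub_cancel' hn.1.le]

/-- Proper prime powers contribute at most `O(√Y log Y)` to each of the shifts of the window. -/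
theorem sum_primePowWindow_le {N A : ℕ} (hN : 1 ≤ N) (hA : A ≤ N) (T : Finset ℕ)
    (hT : ∀ n ∈ T, n ≤ N) :
    ∑ n ∈ T, primePowWindow A n ≤ A * (2 * √(2 * N) * Real.log (2 * N)) := by
  have hN' : (1 : ℝ) ≤ 2 * N := by
    have : (1 : ℝ) ≤ N := by exact_mod_cast hN
    linarith
  have hb := Chebyshev.psi_sub_theta_le hN'
  rw [Chebyshev.psi_sub_theta_eq_sum_not_prime] at hb
  have hfl : ⌊(2 * N : ℝ)⌋₊ = 2 * N := by
    rw [show (2 * N : ℝ) = ((2 * N : ℕ) : ℝ) by push_cast; rfl, Nat.floor_natCast]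
  rw [hfl] at hb
  have hswap : ∑ n ∈ T, primePowWindow A n = ∑ t ∈ Ioc 0 A, ∑ n ∈ T with ¬ (n + t).Prime,
      ArithmeticFunction.vonMangoldt (n + t) := by
    simp only [primePowWindow, Finset.sum_filter]
    rw [Finset.sum_comm]
  rw [hswap]
  calc _ ≤ ∑ t ∈ Ioc 0 A, (2 * √(2 * N) * Real.log (2 * N)) := by
        refine Finset.sum_le_sum fun t ht => le_trans ?_ hb
        rw [mem_Ioc] at ht
        rw [← Finset.sum_image (f := fun m => ArithmeticFunction.vonMangoldt m)
          (g := fun n => n + t) (fun a _ b _ h => Nat.add_right_cancel h)]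
        refine Finset.sum_le_sum_of_subset_of_nonneg ?_
          fun _ _ _ => ArithmeticFunction.vonMangoldt_nonneg
        intro m hm
        obtain ⟨n, hn, rfl⟩ := mem_image.1 hm
        rw [mem_filter] at hn ⊢
        have := hT n hn.1
        exact ⟨mem_Ioc.2 ⟨by omega, by omega⟩, hn.2⟩
    _ = _ := by rw [Finset.sum_const, Nat.card_Ioc, nsmul_eq_mul, Nat.sub_zero]

theorem sum_vonMangoldt_le {n A : ℕ} {ℓ : ℝ} (hℓ : ∀ t ∈ Ioc 0 A, Real.log (n + t) ≤ ℓ) :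
    ∑ t ∈ Ioc 0 A, ArithmeticFunction.vonMangoldt (n + t) ≤
      ℓ * primeWindow A n + primePowWindow A n := by
  rw [← Finset.sum_filter_add_sum_filter_not _ (fun t => (n + t).Prime), primePowWindow]
  refine add_le_add ?_ le_rfl
  rw [primeWindow, mul_comm, ← nsmul_eq_mul]
  refine Finset.sum_le_card_nsmul _ _ _ fun t ht => ?_
  refine ArithmeticFunction.vonMangoldt_le_log.trans ?_
  push_cast
  exact hℓ t (mem_filter.1 ht).1

/-- A convexity bound that is linear in the perturbation `v`, so that it can be summed over primes
with only an average bound for the contribution of prime powers. -/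
theorem add_pow_le_pow_add {u v M : ℝ} (hu : 0 ≤ u) (hv : 0 ≤ v) {k : ℕ} (hk : 0 < k)
    (hM : u + v ≤ M) : (u + v) ^ k ≤ u ^ k + k * M ^ (k - 1) * v := by
  obtain ⟨j, rfl⟩ := Nat.exists_eq_succ_of_ne_zero hk.ne'
  have h := pow_succ_sub_pow_succ_le hu (by linarith : u ≤ u + v) j
  have h2 : (u + v) ^ j ≤ M ^ j := by gcongr
  have h3 : (j + 1 : ℝ) * (u + v - u) * (u + v) ^ j ≤ (j + 1) * v * M ^ j := by
    rw [add_sub_cancel_left]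
    gcongr
  push_cast
  simp only [Nat.succ_eq_add_one]
  linarith

/-- Moments of `ψ` over intervals of length `λ log X` starting at a prime. Up to a factor `1 + o(1)`,
`Λ` is at most `log X` times the indicator of the primes, and proper prime powers are too sparse to
matter. -/
theorem eventually_sum_primes_psi_pow_le {k : ℕ} (hk : 0 < k) {ω lam ε : ℝ} (hω : 1 < ω)
    (hlam : 0 < lam) (hε : 0 < ε) : ∀ᶠ X : ℝ in atTop,
      ∑ p ∈ Nat.primesLE ⌊X⌋₊,
        (Chebyshev.psi ((p : ℝ) + lam * Real.log X) - Chebyshev.psi (p : ℝ)) ^ k ≤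
        (R (k + 1) ω lam + ε) * X * Real.log X ^ (k - 1) := by
  have hR0 : 0 ≤ R (k + 1) ω lam :=
    div_nonneg (P_nonneg _ (by positivity)) (mul_nonneg (by linarith) hlam.le)
  have hpi := eventually_sum_primes_primeWindow_pow_le k hω hlam (half_pos hε)
  set c := R (k + 1) ω lam + ε / 2 with hc
  have hc0 : 0 ≤ c := by positivity
  set D : ℝ := k * (2 * lam) ^ (k - 1) * lam * 8 with hD
  set g : ℝ → ℝ := fun X => (Real.log 2 / Real.log X + 1) ^ k * c +
    D * (Real.log X ^ (2 * k) / √X) with hg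
  have hglim : Tendsto g atTop (𝓝 ((0 + 1) ^ k * c + 0)) :=
    ((((tendsto_const_nhds.div_atTop Real.tendsto_log_atTop).add_const 1).pow k).mul_const c).add
      (tendsto_log_pow_div_sqrt _ _)
  have hlt : (0 + 1) ^ k * c + 0 < R (k + 1) ω lam + ε := by
    rw [hc]; simp; linarith
  have hlin : ∀ᶠ X : ℝ in atTop, lam * Real.log X + 1 ≤ X := by
    have h1 : Tendsto (fun X : ℝ => lam * (Real.log X / X) + 1 / X) atTop (𝓝 (lam * 0 + 0)) :=
      (Real.isLittleO_log_id_atTop.tendsto_div_nhds_zero.const_mul lam).add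
        (tendsto_const_nhds.div_atTop tendsto_id)
    rw [mul_zero, add_zero] at h1
    filter_upwards [h1.eventually (eventually_le_nhds one_pos), eventually_gt_atTop 0]
      with X hX hX0
    rw [mul_div_assoc', ← add_div, div_le_one hX0] at hX
    exact hX
  filter_upwards [hpi, hglim.eventually (eventually_lt_nhds hlt), hlin,
    Real.tendsto_log_atTop.eventually_ge_atTop 1, eventually_ge_atTop 2] with X hX1 hX2 hX3 hX4 hX5
  set L := Real.log X with hL
  have hL0 : 0 < L := by linarith
  have hX0 : 0 < X := by linarith
  set A := ⌊lam * L⌋₊ with hA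
  set N := ⌊X⌋₊ with hN
  have hAle : (A : ℝ) ≤ lam * L := Nat.floor_le (by positivity)
  have hNX : (N : ℝ) ≤ X := Nat.floor_le hX0.le
  have hN1 : 1 ≤ N := Nat.le_floor (by push_cast; linarith)
  have hN1' : (1 : ℝ) ≤ N := by exact_mod_cast hN1
  have hAN : A ≤ N := Nat.floor_le_floor (by linarith)
  set ℓ := Real.log (2 * X) with hℓ
  have hℓL : ℓ = Real.log 2 + L := Real.log_mul (by norm_num) hX0.ne'
  have hℓ2 : ℓ ≤ 2 * L := by
    have : Real.log 2 ≤ L := Real.log_le_log (by norm_num) hX5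
    linarith
  have hℓ0 : 0 ≤ ℓ := by
    have : 0 ≤ Real.log 2 := Real.log_nonneg (by norm_num)
    linarith
  have hlog : ∀ p ∈ Nat.primesLE N, ∀ t ∈ Ioc 0 A, Real.log ((p : ℝ) + t) ≤ ℓ := by
    intro p hp t ht
    have h1 := Nat.le_of_mem_primesLE hp
    have h2 := (mem_Ioc.1 ht).2
    have h3 := (Nat.prime_of_mem_primesLE hp).pos
    have h4 : (p : ℝ) + t ≤ 2 * N := by
      have : p + t ≤ 2 * N := by omega
      exact_mod_cast this
    have h5 : (0 : ℝ) < p := by exact_mod_cast h3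
    exact Real.log_le_log (by positivity) (by linarith)
  have hterm : ∀ p ∈ Nat.primesLE N,
      (Chebyshev.psi ((p : ℝ) + lam * L) - Chebyshev.psi (p : ℝ)) ^ k ≤
        ℓ ^ k * (primeWindow A p : ℝ) ^ k +
          k * (2 * lam * L ^ 2) ^ (k - 1) * primePowWindow A p := by
    intro p hp
    rw [psi_sub_psi p (by positivity), ← hA, ← mul_pow]
    set s := ∑ t ∈ Ioc 0 A, ArithmeticFunction.vonMangoldt (p + t) with hs
    have hs0 : 0 ≤ s := Finset.sum_nonneg fun _ _ => ArithmeticFunction.vonMangoldt_nonneg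
    have h1 : s ≤ ℓ * primeWindow A p + primePowWindow A p := sum_vonMangoldt_le (hlog p hp)
    have h2 : s ≤ 2 * lam * L ^ 2 := by
      calc s ≤ ∑ t ∈ Ioc 0 A, ℓ := Finset.sum_le_sum fun t ht =>
            ArithmeticFunction.vonMangoldt_le_log.trans (by push_cast; exact hlog p hp t ht)
        _ = A * ℓ := by rw [Finset.sum_const, Nat.card_Ioc, nsmul_eq_mul, Nat.sub_zero]
        _ ≤ (lam * L) * (2 * L) := by gcongr
        _ = _ := by ring
    have hv := primePowWindow_nonneg A p
    rcases le_or_gt s (ℓ * primeWindow A p) with h3 | h3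
    · have h4 : s ^ k ≤ (ℓ * primeWindow A p) ^ k := by gcongr
      have h5 : 0 ≤ k * (2 * lam * L ^ 2) ^ (k - 1) * primePowWindow A p := by positivity
      linarith
    · have h4 := add_pow_le_pow_add (u := ℓ * primeWindow A p) (v := s - ℓ * primeWindow A p)
        (by positivity) (by linarith) hk (M := 2 * lam * L ^ 2) (by linarith)
      rw [add_sub_cancel] at h4
      have h5 : k * (2 * lam * L ^ 2) ^ (k - 1) * (s - ℓ * primeWindow A p) ≤
          k * (2 * lam * L ^ 2) ^ (k - 1) * primePowWindow A p := by
        have : s - ℓ * primeWindow A p ≤ primePowWindow A p := by linarith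
        gcongr
      linarith
  have hpp := sum_primePowWindow_le hN1 hAN (Nat.primesLE N) fun p hp => Nat.le_of_mem_primesLE hp
  have hs0 : 0 < √X := Real.sqrt_pos.2 hX0
  have hpp2 : ∑ p ∈ Nat.primesLE N, primePowWindow A p ≤ lam * 8 * L ^ 2 * √X := by
    have h1 : √(2 * N) ≤ 2 * √X := by
      rw [show (2 : ℝ) * √X = √(4 * X) by
        rw [Real.sqrt_mul (by norm_num), show (4 : ℝ) = 2 ^ 2 by norm_num,
          Real.sqrt_sq (by norm_num)]]
      exact Real.sqrt_le_sqrt (by linarith)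
    have h2 : Real.log (2 * N) ≤ 2 * L :=
      (Real.log_le_log (by linarith) (by linarith)).trans hℓ2
    have h3 : 0 ≤ Real.log (2 * N) := Real.log_nonneg (by linarith)
    calc _ ≤ A * (2 * √(2 * N) * Real.log (2 * N)) := hpp
      _ ≤ lam * L * (2 * (2 * √X) * (2 * L)) := by gcongr
      _ = _ := by ring
  have hfirst : ℓ ^ k * (c * (X / L)) = (Real.log 2 / L + 1) ^ k * c * (X * L ^ (k - 1)) := by
    have h1 : ℓ = (Real.log 2 / L + 1) * L := by rw [hℓL]; field_simp
    have h2 : L ^ k = L ^ (k - 1) * L := by rw [← pow_succ, Nat.sub_add_cancel hk]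
    rw [h1, mul_pow, h2]
    field_simp
  have hsecond : k * (2 * lam * L ^ 2) ^ (k - 1) * (lam * 8 * L ^ 2 * √X) ≤
      D * (L ^ (2 * k) / √X) * (X * L ^ (k - 1)) := by
    have h1 : L ^ (2 * k) = (L ^ 2) ^ (k - 1) * L ^ 2 := by
      rw [← pow_mul, ← pow_add]
      congr 1
      omega
    have h2 : k * (2 * lam * L ^ 2) ^ (k - 1) * (lam * 8 * L ^ 2 * √X) =
        D * (L ^ (2 * k) / √X) * X := by
      rw [hD, h1, mul_pow _ (L ^ 2)]
      have : √X * √X = X := Real.mul_self_sqrt hX0.le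
      field_simp
      linear_combination this
    rw [h2, ← mul_assoc]
    refine le_mul_of_one_le_right ?_ (one_le_pow₀ hX4)
    positivity
  calc _ ≤ ∑ p ∈ Nat.primesLE N, (ℓ ^ k * (primeWindow A p : ℝ) ^ k +
          k * (2 * lam * L ^ 2) ^ (k - 1) * primePowWindow A p) := Finset.sum_le_sum hterm
    _ = ℓ ^ k * ∑ p ∈ Nat.primesLE N, (primeWindow A p : ℝ) ^ k +
          k * (2 * lam * L ^ 2) ^ (k - 1) * ∑ p ∈ Nat.primesLE N, primePowWindow A p := by
        rw [Finset.sum_add_distrib, Finset.mul_sum, Finset.mul_sum]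
    _ ≤ ℓ ^ k * (c * (X / L)) + k * (2 * lam * L ^ 2) ^ (k - 1) * (lam * 8 * L ^ 2 * √X) := by
        gcongr
    _ ≤ g X * (X * L ^ (k - 1)) := by
        rw [hfirst, hg]
        simp only [← hL]
        linarith
    _ ≤ (R (k + 1) ω lam + ε) * (X * L ^ (k - 1)) := by gcongr
    _ = _ := by ring

end PrimeMoments

theorem mainTheorem6 (k : ℕ) (hk : 2 ≤ k) (ω : ℝ) (hω : 1 < ω) (lam : ℝ) (hlam : 0 < lam)
    (ε : ℝ) (hε : 0 < ε) :
    ∀ᶠ X : ℝ in Filter.atTop,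
      (∑ p ∈ Nat.primesLE ⌊X⌋₊,
          (Chebyshev.psi ((p : ℝ) + lam * Real.log X) - Chebyshev.psi (p : ℝ)) ^ k
        ≤ (PrimeMoments.R (k + 1) ω lam + ε) * X * Real.log X ^ (k - 1)) ∧
      (∑ p ∈ Nat.primesLE ⌊X⌋₊,
          (PrimeMoments.primePi ((p : ℝ) + lam * Real.log X) - PrimeMoments.primePi (p : ℝ)) ^ k
        ≤ (PrimeMoments.R (k + 1) ω lam + ε) * (X / Real.log X)) := by
  refine (PrimeMoments.eventually_sum_primes_psi_pow_le (by omega) hω hlam hε).and ?_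
  filter_upwards [PrimeMoments.eventually_sum_primes_primeWindow_pow_le k hω hlam hε,
    Filter.eventually_ge_atTop 1] with X hX hX1
  have hlog : 0 ≤ lam * Real.log X := mul_nonneg hlam.le (Real.log_nonneg hX1)
  simp only [PrimeMoments.primePi_sub_primePi _ hlog]
  exact hX
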